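/- Let $a_n>0$, $b_n\in\mathbb R$ $(n\ge 0)$, and let $J$ be a self-adjoint extension in $\ell^2(\mathbb Z_+)$ of the minimal Jacobi operator $J_0$ given by $(J_0u)_n=a_{n-1}u_{n-1}+b_nu_n+a_nu_{n+1}$ $(a_{-1}=0)$ on vectors with finitely many non-zero components. Let $E_J$ be the spectral family of $J$, let $d\rho(\lambda)=d(E_J(\lambda)e_0,e_0)$, $e_0=(1,0,0,\dots)$, be its spectral measure, and let $P_n$ be the corresponding orthonormal polynomials: $P_0=1$, $a_{n-1}P_{n-1}(\lambda)+b_nP_n(\lambda)+a_nP_{n+1}(\lambda)=\lambda P_n(\lambda)$ for $n\ge 0$. Let $\Lambda\subset\mathbb R$ be a non-empty open interval (bounded or not) on which $d\rho(\lambda)=\tau(\lambda)\,d\lambda$ with $\tau\in C^\infty(\Lambda)$, $\tau>0$ on $\Lambda$. Let $\kappa,\omega:\Lambda\to\mathbb R$ and $\Phi_n:\Lambda\to\mathbb R$ $(n\ge 0)$. For real sequences $(x_n)_{n\ge0}$, $(v_n)_{n\ge0}$ we say that (ASY) holds if $$P_n(\lambda)=2\kappa(\lambda)v_n\cos\big(\omega(\lambda)x_n+\Phi_n(\lambda)\big)+\epsilon_n(\lambda),\qquad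 \lambda\in\Lambda,$$ where: * $x_{n+1}>x_n$ and $v_n>0$ for all sufficiently large $n$, $x_n\to\infty$, and $\sum_n v_n^2x_n^{-2k}<\infty$ for some real $k>0$ (the sum being over all sufficiently large $n$); * $\omega,\kappa\in C^\infty(\Lambda)$, $\kappa>0$ and $\omega'>0$ on $\Lambda$; * $\Phi_n\in C^\infty(\Lambda)$ and, as $n\to\infty$, uniformly on compact subintervals of $\Lambda$, $\Phi_n^{(k)}(\lambda)=o(x_n)$ for $k=1,2$ and $\Phi_n^{(k)}(\lambda)=O(x_n)$ for every $k\ge3$; * for every compact subinterval $K\subset\Lambda$, $\sup_{\lambda\in K}\sum_{n=0}^\infty|\epsilon_n(\lambda)|^2<\infty$. Then: 1. Suppose that (ASY) holds for $(x_n)$, $(v_n)$, that $(x_{n+1}-x_n)/x_n\to0$, and that $\sigma_n=v_n^2/(x_{n+1}-x_n)$ has a limit $\sigma$ as $n\to\infty$, possibly infinite. Then necessarily $0<\sigma<\infty$ and $$2\pi\sigma\,\tau(\lambda)\,\kappa^2(\lambda)=\omega'(\lambda)\qquad\text{for all }\lambda\in\Lambda.$$ 2. In particular, if (ASY) holds with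 $x_n=n^s$ and $v_n=n^{-r}$ for $n\ge 1$, where $r,s\in\mathbb R$ (so that $s>0$, since $x_n\to\infty$), then $$2r+s=1\quad\text{and}\quad 2\pi\,\tau(\lambda)\,\kappa^2(\lambda)=s\,\omega'(\lambda)\qquad\text{for all }\lambda\in\Lambda.$$ -/

import Mathlib

open MeasureTheory Filter Topology


noncomputable section

/-- The complex Hilbert space `ℓ²(ℤ₊)`. -/
abbrev EllTwo : Type := lp (fun _ : ℕ => ℂ) 2

/-- The vector `e₀ = (1, 0, 0, …)`. -/
def basisZero : EllTwo := lp.single 2 0 (1 : ℂ)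

/-- The Jacobi difference expression
`(J u)_n = a_{n-1} u_{n-1} + b_n u_n + a_n u_{n+1}` with `a_{-1} = 0`. -/
def jacobiExpr (a b : ℕ → ℝ) (u : ℕ → ℂ) (n : ℕ) : ℂ :=
  (if n = 0 then 0 else (a (n - 1) : ℂ) * u (n - 1)) + (b n : ℂ) * u n + (a n : ℂ) * u (n + 1)

theorem jacobiExpr_memlp (a b : ℕ → ℝ) {u : ℕ → ℂ} (hu : {n | u n ≠ 0}.Finite) :
    Memℓp (E := fun _ : ℕ => ℂ) (jacobiExpr a b u) 2 := by
  refine (memℓp_zero ?_).of_exponent_ge (zero_le)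
  obtain ⟨N, hN⟩ := hu.bddAbove
  have h0 : ∀ m, N < m → u m = 0 := by
    intro m hm
    by_contra h
    exact absurd (hN h) (not_le.mpr hm)
  refine (Set.finite_Iic (N + 1)).subset ?_
  intro n hn
  by_contra h
  have h' : N + 1 < n := by simpa using h
  apply hn
  simp [jacobiExpr, h0 (n - 1) (by omega), h0 n (by omega), h0 (n + 1) (by omega)]

/-- The subspace of vectors with only finitely many non-zero components. -/
def finiteVectors : Submodule ℂ EllTwo where
  carrier := {u | {n | u n ≠ 0}.Finite}
  zero_mem' := by simp
  add_mem' := by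
    intro u w hu hw
    refine (Set.Finite.union hu hw).subset ?_
    intro n hn
    by_contra h
    simp only [Set.mem_union, Set.mem_ofPred_eq, not_or, not_not] at h
    apply hn
    simp [h.1, h.2]
  smul_mem' := by
    intro c u hu
    refine Set.Finite.subset hu ?_
    intro n hn h
    apply hn
    simp [h]

/-- The minimal Jacobi operator `J₀` with coefficients `a_n`, `b_n`, defined on the vectors
with finitely many non-zero components. -/
def jacobiMin (a b : ℕ → ℝ) : EllTwo →ₗ.[ℂ] EllTwo where
  domain := finiteVectors
  toFun :=
    { toFun := fun u => ⟨jacobiExpr a b (u : EllTwo), jacobiExpr_memlp a b u.2⟩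
      map_add' := by
        intro u w
        ext n
        simp only [jacobiExpr, Submodule.coe_add, lp.coeFn_add, Pi.add_apply]
        split_ifs <;> ring
      map_smul' := by
        intro c u
        ext n
        simp only [jacobiExpr, Submodule.coe_smul, lp.coeFn_smul, Pi.smul_apply, smul_eq_mul,
          RingHom.id_apply]
        split_ifs <;> ring }

/-- The polynomials with `P_0 = 1` and
`a_{n-1} P_{n-1} + b_n P_n + a_n P_{n+1} = X P_n` for `n ≥ 0` (where `a_{-1} = 0`). -/
def jacobiPoly (a b : ℕ → ℝ) : ℕ → Polynomial ℝ
  | 0 => 1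
  | 1 => Polynomial.C (a 0)⁻¹ * (Polynomial.X - Polynomial.C (b 0))
  | n + 2 => Polynomial.C (a (n + 1))⁻¹ *
      ((Polynomial.X - Polynomial.C (b (n + 1))) * jacobiPoly a b (n + 1)
        - Polynomial.C (a n) * jacobiPoly a b n)

/-- A projection-valued measure on the Borel sets of `ℝ` (a spectral family) in a complex
Hilbert space: its values are orthogonal projections and it is strongly countably additive.
The values on non-measurable sets play no role. -/
structure ProjectionMeasure (H : Type*) [NormedAddCommGroup H] [InnerProductSpace ℂ H]
    [CompleteSpace H] where
  proj : Set ℝ → H →L[ℂ] H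
  isStarProjection : ∀ B, MeasurableSet B → IsStarProjection (proj B)
  proj_univ : proj Set.univ = 1
  proj_inter : ∀ B C, MeasurableSet B → MeasurableSet C → proj (B ∩ C) = proj B * proj C
  hasSum_proj : ∀ B : ℕ → Set ℝ, (∀ i, MeasurableSet (B i)) →
    Pairwise (Function.onFun Disjoint B) → ∀ u : H,
      HasSum (fun i => proj (B i) u) (proj (⋃ i, B i) u)

namespace ProjectionMeasure

variable {H : Type*} [NormedAddCommGroup H] [InnerProductSpace ℂ H] [CompleteSpace H]

theorem re_inner_nonneg (E : ProjectionMeasure H) {B : Set ℝ} (hB : MeasurableSet B) (u : H) :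
    0 ≤ (inner ℂ u (E.proj B u)).re := by
  have h := E.isStarProjection B hB
  have h1 : E.proj B u = E.proj B (E.proj B u) := by
    conv_lhs => rw [← h.isIdempotentElem.eq]
    rfl
  have h2 : inner ℂ u (E.proj B u) = inner ℂ (E.proj B u) (E.proj B u) := by
    conv_lhs => rw [h1]
    rw [← ContinuousLinearMap.adjoint_inner_left]
    rw [← ContinuousLinearMap.star_eq_adjoint, h.isSelfAdjoint.star_eq]
  rw [h2]
  exact inner_self_nonneg (𝕜 := ℂ)

theorem proj_empty (E : ProjectionMeasure H) (u : H) : E.proj ∅ u = 0 := by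
  have h := E.hasSum_proj (fun _ => ∅) (fun _ => MeasurableSet.empty)
    (fun _ _ _ => by simp [Function.onFun]) u
  have h' := h.summable.tendsto_atTop_zero
  exact tendsto_nhds_unique tendsto_const_nhds h'

/-- The scalar measure `B ↦ (E(B) u, u)`. -/
def measure (E : ProjectionMeasure H) (u : H) : Measure ℝ :=
  Measure.ofMeasurable (fun B _ => ENNReal.ofReal (inner ℂ u (E.proj B u)).re)
    (by simp [proj_empty])
    (by
      intro B hB hd
      have h := E.hasSum_proj B hB hd u
      have h1 : HasSum (fun i => (inner ℂ u (E.proj (B i) u)).re)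
          (inner ℂ u (E.proj (⋃ i, B i) u)).re :=
        Complex.hasSum_re ((innerSL ℂ u).hasSum h)
      rw [← h1.tsum_eq, ENNReal.ofReal_tsum_of_nonneg (fun i => E.re_inner_nonneg (hB i) u)
        h1.summable])

end ProjectionMeasure

/-- `E` is the spectral family of the operator `J`, that is `J = ∫ t dE(t)`: the domain of `J`
is the set of `u` with `∫ t² d(E(t)u, u) < ∞`, and `(J u, u) = ∫ t d(E(t)u, u)` for such `u`
(by polarization, this determines `J`). -/
def IsSpectralFamily {H : Type*} [NormedAddCommGroup H] [InnerProductSpace ℂ H]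
    [CompleteSpace H] (J : H →ₗ.[ℂ] H) (E : ProjectionMeasure H) : Prop :=
  (∀ u : H, u ∈ J.domain ↔ Integrable (fun t : ℝ => t ^ 2) (E.measure u)) ∧
  ∀ u : J.domain, inner ℂ (u : H) (J u) = ((∫ t, t ∂(E.measure (u : H)) : ℝ) : ℂ)

/-- The remainder `ε_n(l) = P_n(l) - 2 κ(l) v_n cos(ω(l) x_n + Φ_n(l))`. -/
def asymRemainder (a b : ℕ → ℝ) (κ ω : ℝ → ℝ) (x v : ℕ → ℝ) (Φ : ℕ → ℝ → ℝ)
    (n : ℕ) (l : ℝ) : ℝ :=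
  (jacobiPoly a b n).eval l - 2 * κ l * v n * Real.cos (ω l * x n + Φ n l)

/-- The asymptotic formula `P_n(l) = 2 κ(l) v_n cos(ω(l) x_n + Φ_n(l)) + ε_n(l)` on the open
interval `Λ`, with all conditions on its ingredients; the estimates are uniform on compact
subintervals of `Λ`. -/
structure HasOscillatingAsymptotics (a b : ℕ → ℝ) (Λ : Set ℝ) (κ ω : ℝ → ℝ)
    (x v : ℕ → ℝ) (Φ : ℕ → ℝ → ℝ) : Prop where
  x_lt : ∀ᶠ n in atTop, x n < x (n + 1)
  x_tendsto : Tendsto x atTop atTop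
  v_pos : ∀ᶠ n in atTop, 0 < v n
  summable : ∃ k : ℝ, 0 < k ∧ Summable fun n => v n ^ 2 * x n ^ (-(2 * k))
  ω_smooth : ContDiffOn ℝ (⊤ : ℕ∞) ω Λ
  κ_smooth : ContDiffOn ℝ (⊤ : ℕ∞) κ Λ
  κ_pos : ∀ l ∈ Λ, 0 < κ l
  ω_deriv_pos : ∀ l ∈ Λ, 0 < deriv ω l
  Φ_smooth : ∀ n, ContDiffOn ℝ (⊤ : ℕ∞) (Φ n) Λ
  Φ_deriv_isLittleO : ∀ k : ℕ, k = 1 ∨ k = 2 → ∀ α β : ℝ, Set.Icc α β ⊆ Λ →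
    ∀ δ : ℝ, 0 < δ → ∀ᶠ n in atTop, ∀ l ∈ Set.Icc α β, |iteratedDeriv k (Φ n) l| ≤ δ * x n
  Φ_deriv_isBigO : ∀ k : ℕ, 3 ≤ k → ∀ α β : ℝ, Set.Icc α β ⊆ Λ →
    ∃ C : ℝ, ∀ᶠ n in atTop, ∀ l ∈ Set.Icc α β, |iteratedDeriv k (Φ n) l| ≤ C * x n
  remainder : ∀ α β : ℝ, Set.Icc α β ⊆ Λ → ∃ C : ℝ, ∀ l ∈ Set.Icc α β,
    Summable (fun n => asymRemainder a b κ ω x v Φ n l ^ 2) ∧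
      ∑' n, asymRemainder a b κ ω x v Φ n l ^ 2 ≤ C

end

/-! The mechanism is a count of frequencies. Under the spectral representation generated by `e₀`,
`J` is multiplication by `t` and `e_n` corresponds to `P_n` (`represents_polyFun`). Reading `(∫ F
dE) e₀` in the standard basis of `ℓ²` gives Parseval's identity `∑ |∫ F P_n dρ|² = ∫ |F|² dρ`;
density of polynomials is not needed.

Take a bump `g` supported inside `Λ` and `F(t) = exp(-2πitu) g / (κτ)`. Then `∑ₙ |𝓕(g P_n / κ)(u)|²
= Q` for every real `u`, with `Q = ∫ g² / (κ²τ)`; integrating over `|u| ≤ S` gives the total `2SQ`.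
Substitute (ASY). By Plancherel the remainders contribute an amount bounded independently of `S`,
so, up to factors `1 + δ` and additive constants, `2SQ` equals `∑ v_n² W_n(S)`, where `W_n(S)` is
the mass of `𝓕(2g cos θ_n)` in the window `[-S, S]` and `θ_n = ω x_n + Φ_n`.

The frequencies of `2g cos θ_n` lie near `±ω' x_n / 2π`. By non-stationary phase (`window_bounds`),
`W_n(S)` is nearly `2G`, `G = ∫ g²`, when `x_n` is below about `2πS/ω'`, and is `O(S / x_n²)` when
it is above. If `v_n²` is comparable to `s (x_{n+1} - x_n)`, the sum telescopes to about `2G · s ·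
2πS/ω'`. Comparing slopes in `S` gives inequalities between `ω' Q` and `2πsG` (`bump_inequalities`),
and shrinking the support of `g` to a point gives inequalities between `ω'` and `2πs κ²τ`
(`density_bounds`).

Every `s < σ` is thus bounded above and every `s > σ` bounded below by the same positive number `ω'
/ (2πκ²τ)`; this excludes `σ = 0` and `σ = ∞` and yields the identity. For powers, `σ_n` behaves
like `n^(1-2r-s) / s`, so a nonzero exponent would produce an excluded limit. -/

noncomputable section

/-! ### Functional calculus: the isometry from `L²` of a spectral measure -/

namespace ProjectionMeasure

variable {H : Type*} [NormedAddCommGroup H] [InnerProductSpace ℂ H] [CompleteSpace H]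

theorem inner_proj_left (E : ProjectionMeasure H) {B : Set ℝ} (hB : MeasurableSet B) (w u : H) :
    inner ℂ (E.proj B w) u = inner ℂ w (E.proj B u) := by
  have h := (E.isStarProjection B hB).isSelfAdjoint.star_eq
  rw [← ContinuousLinearMap.adjoint_inner_right, ← ContinuousLinearMap.star_eq_adjoint, h]

theorem proj_proj (E : ProjectionMeasure H) {B C : Set ℝ} (hB : MeasurableSet B)
    (hC : MeasurableSet C) (u : H) : E.proj B (E.proj C u) = E.proj (B ∩ C) u := by
  rw [E.proj_inter B C hB hC]; rfl

theorem inner_proj_proj (E : ProjectionMeasure H) {B C : Set ℝ} (hB : MeasurableSet B)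
    (hC : MeasurableSet C) (w u : H) :
    inner ℂ (E.proj B w) (E.proj C u) = inner ℂ w (E.proj (B ∩ C) u) := by
  rw [E.inner_proj_left hB, E.proj_proj hB hC]

theorem inner_proj_self (E : ProjectionMeasure H) {B : Set ℝ} (hB : MeasurableSet B) (u : H) :
    inner ℂ u (E.proj B u) = ((‖E.proj B u‖ ^ 2 : ℝ) : ℂ) := by
  have := E.inner_proj_proj hB hB u u
  rw [Set.inter_self] at this
  rw [← this, inner_self_eq_norm_sq_to_K]
  norm_cast

theorem measure_apply (E : ProjectionMeasure H) {B : Set ℝ} (hB : MeasurableSet B) (u : H) :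
    E.measure u B = ENNReal.ofReal (‖E.proj B u‖ ^ 2) := by
  rw [measure, Measure.ofMeasurable_apply B hB, E.inner_proj_self hB, Complex.ofReal_re]

instance (E : ProjectionMeasure H) (u : H) : IsFiniteMeasure (E.measure u) :=
  ⟨by rw [E.measure_apply MeasurableSet.univ]; exact ENNReal.ofReal_lt_top⟩

theorem measureReal_apply (E : ProjectionMeasure H) {B : Set ℝ} (hB : MeasurableSet B) (u : H) :
    (E.measure u).real B = ‖E.proj B u‖ ^ 2 := by
  rw [Measure.real, E.measure_apply hB, ENNReal.toReal_ofReal (by positivity)]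

/-- The finite combinations of indicators, as elements of `L²`. -/
def indicatorCombination (μ : Measure ℝ) [IsFiniteMeasure μ] :
    ({B : Set ℝ // MeasurableSet B} →₀ ℂ) →ₗ[ℂ] Lp ℂ 2 μ :=
  Finsupp.linearCombination ℂ fun B =>
    indicatorConstLp 2 B.2 (measure_ne_top μ (B : Set ℝ)) (1 : ℂ)

theorem indicatorConstLp_eq_smul (μ : Measure ℝ) [IsFiniteMeasure μ] {B : Set ℝ}
    (hB : MeasurableSet B) (c : ℂ) (h : μ B ≠ ⊤) :
    indicatorConstLp 2 hB h c = c • indicatorConstLp 2 hB h (1 : ℂ) := by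
  apply Lp.ext
  filter_upwards [Lp.coeFn_smul c (indicatorConstLp 2 hB h (1 : ℂ)),
    indicatorConstLp_coeFn (p := 2) (hs := hB) (hμs := h) (c := (1 : ℂ)),
    indicatorConstLp_coeFn (p := 2) (hs := hB) (hμs := h) (c := c)] with t h1 h2 h3
  rw [h1, h3, Pi.smul_apply, h2]
  by_cases ht : t ∈ B <;> simp [ht]

theorem denseRange_indicatorCombination (μ : Measure ℝ) [IsFiniteMeasure μ] :
    DenseRange (indicatorCombination μ) := by
  intro F
  have key : F ∈ (LinearMap.range (indicatorCombination μ)).topologicalClosure := by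
    refine Lp.induction (p := 2) (by norm_num)
      (fun F : Lp ℂ 2 μ => F ∈ (LinearMap.range (indicatorCombination μ)).topologicalClosure)
      ?_ ?_ ?_ F
    · intro c s hs hμs
      apply Submodule.le_topologicalClosure
      refine ⟨Finsupp.single ⟨s, hs⟩ c, ?_⟩
      rw [indicatorCombination, Finsupp.linearCombination_single, ← indicatorConstLp_eq_smul]
      rfl
    · intro f g hf hg _ h1 h2
      exact Submodule.add_mem _ h1 h2
    · exact Submodule.isClosed_topologicalClosure _
  exact key

/-- The finite combinations of the vectors `E(B) u`. -/
def projCombination (E : ProjectionMeasure H) (u : H) :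
    ({B : Set ℝ // MeasurableSet B} →₀ ℂ) →ₗ[ℂ] H :=
  Finsupp.linearCombination ℂ fun B => E.proj B u

/-- By sesquilinearity it is enough that `⟨E(B)u, E(C)u⟩ = ‖E(B ∩ C)u‖² = μ(B ∩ C)`. This makes the
map from simple functions to vectors isometric, so it extends to all of `L²`. -/
theorem inner_projCombination (E : ProjectionMeasure H) (u : H)
    (x y : {B : Set ℝ // MeasurableSet B} →₀ ℂ) :
    inner ℂ (E.projCombination u x) (E.projCombination u y) =
      inner ℂ (indicatorCombination (E.measure u) x) (indicatorCombination (E.measure u) y) := by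
  induction x using Finsupp.induction_linear with
  | zero => simp
  | add x₁ x₂ h₁ h₂ => simp only [map_add, inner_add_left, h₁, h₂]
  | single B c =>
    induction y using Finsupp.induction_linear with
    | zero => simp
    | add x₁ x₂ h₁ h₂ => simp only [map_add, inner_add_right, h₁, h₂]
    | single C d =>
      simp only [projCombination, indicatorCombination, Finsupp.linearCombination_single,
        inner_smul_left, inner_smul_right]
      rw [E.inner_proj_proj B.2 C.2, E.inner_proj_self (B.2.inter C.2),
        L2.inner_indicatorConstLp_one_indicatorConstLp_one B.2 C.2,
        E.measureReal_apply (B.2.inter C.2)]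
      norm_num

theorem norm_projCombination (E : ProjectionMeasure H) (u : H)
    (x : {B : Set ℝ // MeasurableSet B} →₀ ℂ) :
    ‖E.projCombination u x‖ = ‖indicatorCombination (E.measure u) x‖ := by
  rw [@norm_eq_sqrt_re_inner ℂ, @norm_eq_sqrt_re_inner ℂ, inner_projCombination]

/-- The isometry `F ↦ (∫ F dE) u` of `L²` of the spectral measure of `u` into the space. -/
def integralMap (E : ProjectionMeasure H) (u : H) : Lp ℂ 2 (E.measure u) →L[ℂ] H :=
  (E.projCombination u).extendOfNorm (indicatorCombination (E.measure u))

theorem integralMap_indicatorCombination (E : ProjectionMeasure H) (u : H)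
    (x : {B : Set ℝ // MeasurableSet B} →₀ ℂ) :
    E.integralMap u (indicatorCombination (E.measure u) x) = E.projCombination u x :=
  LinearMap.extendOfNorm_eq (denseRange_indicatorCombination _)
    ⟨1, fun x => by rw [one_mul, norm_projCombination]⟩ x

theorem integralMap_indicator (E : ProjectionMeasure H) (u : H) {B : Set ℝ}
    (hB : MeasurableSet B) :
    E.integralMap u (indicatorConstLp 2 hB (measure_ne_top _ B) (1 : ℂ)) = E.proj B u := by
  have := E.integralMap_indicatorCombination u (Finsupp.single ⟨B, hB⟩ 1)
  simpa [indicatorCombination, projCombination] using this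

theorem inner_integralMap (E : ProjectionMeasure H) (u : H) (F G : Lp ℂ 2 (E.measure u)) :
    inner ℂ (E.integralMap u F) (E.integralMap u G) = inner ℂ F G := by
  refine (denseRange_indicatorCombination (E.measure u)).induction_on₂
    (p := fun F G => inner ℂ (E.integralMap u F) (E.integralMap u G) = inner ℂ F G) ?_ ?_ F G
  · exact isClosed_eq (by fun_prop) (by fun_prop)
  · intro x y
    rw [integralMap_indicatorCombination, integralMap_indicatorCombination, inner_projCombination]

theorem norm_integralMap (E : ProjectionMeasure H) (u : H) (F : Lp ℂ 2 (E.measure u)) :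
    ‖E.integralMap u F‖ = ‖F‖ := by
  rw [@norm_eq_sqrt_re_inner ℂ, @norm_eq_sqrt_re_inner ℂ, inner_integralMap]

/-- Multiplication by the indicator of a set, on `L²`. -/
def indicatorMul (μ : Measure ℝ) {B : Set ℝ} (hB : MeasurableSet B) :
    Lp ℂ 2 μ →L[ℂ] Lp ℂ 2 μ :=
  LinearMap.mkContinuous
    { toFun := fun F => ((Lp.memLp F).indicator hB).toLp
      map_add' := by
        intro F G
        rw [← MemLp.toLp_add]
        apply MemLp.toLp_congr
        filter_upwards [Lp.coeFn_add F G] with t ht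
        rw [Pi.add_apply] at ht
        by_cases h : t ∈ B
        · simp only [Pi.add_apply, Set.indicator_of_mem h]
          exact ht
        · simp [h]
      map_smul' := by
        intro c F
        rw [RingHom.id_apply, ← MemLp.toLp_const_smul]
        apply MemLp.toLp_congr
        filter_upwards [Lp.coeFn_smul c F] with t ht
        by_cases h : t ∈ B
        · simp only [Pi.smul_apply, Set.indicator_of_mem h]
          exact ht
        · simp [h] } 1 (by
    intro F
    rw [one_mul]
    apply Lp.norm_le_norm_of_ae_le
    filter_upwards [((Lp.memLp F).indicator hB).coeFn_toLp] with t ht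
    change ‖(((Lp.memLp F).indicator hB).toLp : Lp ℂ 2 μ) t‖ ≤ _
    rw [ht]
    exact norm_indicator_le_norm_self _ _)

theorem indicatorMul_coeFn (μ : Measure ℝ) {B : Set ℝ} (hB : MeasurableSet B) (F : Lp ℂ 2 μ) :
    indicatorMul μ hB F =ᵐ[μ] B.indicator F :=
  ((Lp.memLp F).indicator hB).coeFn_toLp

theorem proj_integralMap (E : ProjectionMeasure H) (u : H) {B : Set ℝ} (hB : MeasurableSet B)
    (F : Lp ℂ 2 (E.measure u)) :
    E.proj B (E.integralMap u F) = E.integralMap u (indicatorMul _ hB F) := by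
  refine (denseRange_indicatorCombination (E.measure u)).induction_on
    (p := fun F => E.proj B (E.integralMap u F) = E.integralMap u (indicatorMul _ hB F)) F ?_ ?_
  · exact isClosed_eq (by fun_prop) (by fun_prop)
  · intro x
    induction x using Finsupp.induction_linear with
    | zero => simp
    | add x₁ x₂ h₁ h₂ => simp only [map_add, h₁, h₂]
    | single C c =>
      simp only [indicatorCombination, Finsupp.linearCombination_single, map_smul,
        E.integralMap_indicator u C.2, E.proj_proj hB C.2]
      congr 1
      rw [← E.integralMap_indicator u (hB.inter C.2)]
      congr 1
      apply Lp.ext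
      filter_upwards [indicatorMul_coeFn (E.measure u) hB
        (indicatorConstLp 2 C.2 (measure_ne_top _ (C : Set ℝ)) (1 : ℂ)),
        indicatorConstLp_coeFn (p := 2) (hs := C.2) (hμs := measure_ne_top (E.measure u) (C : Set ℝ))
          (c := (1 : ℂ)),
        indicatorConstLp_coeFn (p := 2) (hs := hB.inter C.2)
          (hμs := measure_ne_top (E.measure u) (B ∩ C : Set ℝ)) (c := (1 : ℂ))] with t h1 h2 h3
      rw [h1, h3]
      by_cases h : t ∈ B
      · rw [Set.indicator_of_mem h, h2, ← Set.indicator_indicator, Set.indicator_of_mem h]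
      · simp [h]

/-- `E(B)` acts on the `L²` side as multiplication by the indicator of `B`, so the isometry gives
`‖E(B)h‖² = ∫_B |F|² dμ`. -/
theorem measure_integralMap (E : ProjectionMeasure H) (u : H) (F : Lp ℂ 2 (E.measure u)) :
    E.measure (E.integralMap u F) =
      (E.measure u).withDensity (fun t => ENNReal.ofReal (‖F t‖ ^ 2)) := by
  have hF : Integrable (fun t => ‖F t‖ ^ 2) (E.measure u) :=
    (memLp_two_iff_integrable_sq_norm (Lp.memLp F).1).1 (Lp.memLp F)
  ext B hB
  rw [E.measure_apply hB, withDensity_apply _ hB, E.proj_integralMap u hB, norm_integralMap,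
    ← ofReal_integral_eq_lintegral_ofReal hF.integrableOn (ae_of_all _ fun t => by positivity)]
  congr 1
  have h := L2.inner_def (𝕜 := ℂ) (indicatorMul (E.measure u) hB F) (indicatorMul (E.measure u) hB F)
  rw [inner_self_eq_norm_sq_to_K] at h
  have h2 : (fun t => inner ℂ (indicatorMul (E.measure u) hB F t)
      (indicatorMul (E.measure u) hB F t)) =ᵐ[E.measure u]
      fun t => ((B.indicator (fun t => ‖F t‖ ^ 2) t : ℝ) : ℂ) := by
    filter_upwards [indicatorMul_coeFn (E.measure u) hB F] with t ht
    rw [ht, inner_self_eq_norm_sq_to_K]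
    by_cases hh : t ∈ B <;> simp [hh]
  rw [integral_congr_ae h2] at h
  rw [← integral_indicator hB, ← Complex.ofReal_inj, ← integral_complex_ofReal, ← h]
  norm_cast

end ProjectionMeasure

/-! ### The operator as multiplication by `t` -/

namespace ProjectionMeasure

variable {H : Type*} [NormedAddCommGroup H] [InnerProductSpace ℂ H] [CompleteSpace H]

/-- The vector `h` is `(∫ F dE) u`. -/
def Represents (E : ProjectionMeasure H) (u : H) (F : ℝ → ℂ) (h : H) : Prop :=
  ∃ hF : MemLp F 2 (E.measure u), E.integralMap u hF.toLp = h

theorem Represents.add {E : ProjectionMeasure H} {u x y : H} {F G : ℝ → ℂ}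
    (hx : E.Represents u F x) (hy : E.Represents u G y) :
    E.Represents u (fun t => F t + G t) (x + y) := by
  obtain ⟨hF, rfl⟩ := hx
  obtain ⟨hG, rfl⟩ := hy
  refine ⟨hF.add hG, ?_⟩
  rw [← map_add, ← MemLp.toLp_add]
  rfl

theorem Represents.const_mul {E : ProjectionMeasure H} {u x : H} {F : ℝ → ℂ}
    (hx : E.Represents u F x) (c : ℂ) : E.Represents u (fun t => c * F t) (c • x) := by
  obtain ⟨hF, rfl⟩ := hx
  refine ⟨hF.const_mul c, ?_⟩
  rw [← map_smul, ← MemLp.toLp_const_smul]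
  rfl

theorem represents_zero (E : ProjectionMeasure H) (u : H) : E.Represents u (fun _ => 0) 0 :=
  ⟨MemLp.zero', by rw [show (MemLp.zero' : MemLp (fun _ => (0 : ℂ)) 2 (E.measure u)).toLp = 0 from
    MemLp.toLp_zero _, map_zero]⟩

theorem represents_one (E : ProjectionMeasure H) (u : H) : E.Represents u (fun _ => 1) u := by
  refine ⟨memLp_const 1, ?_⟩
  have h := E.integralMap_indicator u MeasurableSet.univ
  rw [E.proj_univ] at h
  rw [indicatorConstLp_univ] at h
  exact h

theorem represents_integralMap (E : ProjectionMeasure H) (u : H) (F : Lp ℂ 2 (E.measure u)) :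
    E.Represents u F (E.integralMap u F) :=
  ⟨Lp.memLp F, by rw [Lp.toLp_coeFn]⟩

theorem Represents.inner_eq {E : ProjectionMeasure H} {u x y : H} {F G : ℝ → ℂ}
    (hx : E.Represents u F x) (hy : E.Represents u G y) :
    inner ℂ x y = ∫ t, G t * (starRingEnd ℂ) (F t) ∂(E.measure u) := by
  obtain ⟨hF, rfl⟩ := hx
  obtain ⟨hG, rfl⟩ := hy
  rw [inner_integralMap, L2.inner_def]
  apply integral_congr_ae
  filter_upwards [hF.coeFn_toLp, hG.coeFn_toLp] with t h1 h2
  rw [h1, h2]; rfl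

theorem Represents.measure_eq {E : ProjectionMeasure H} {u x : H} {F : ℝ → ℂ}
    (hx : E.Represents u F x) :
    E.measure x = (E.measure u).withDensity (fun t => ENNReal.ofReal (‖F t‖ ^ 2)) := by
  obtain ⟨hF, rfl⟩ := hx
  rw [measure_integralMap]
  apply withDensity_congr_ae
  filter_upwards [hF.coeFn_toLp] with t h1
  rw [h1]

theorem Represents.integrable_iff {E : ProjectionMeasure H} {u x : H} {F : ℝ → ℂ}
    (hx : E.Represents u F x) (g : ℝ → ℝ) :
    Integrable g (E.measure x) ↔ Integrable (fun t => g t * ‖F t‖ ^ 2) (E.measure u) := by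
  have hm : AEMeasurable (fun t => ENNReal.ofReal (‖F t‖ ^ 2)) (E.measure u) :=
    ENNReal.measurable_ofReal.comp_aemeasurable (hx.1.1.norm.aemeasurable.pow_const 2)
  rw [hx.measure_eq, integrable_withDensity_iff_integrable_smul₀' hm (by simp)]
  apply integrable_congr
  filter_upwards with t
  rw [ENNReal.toReal_ofReal (by positivity), smul_eq_mul, mul_comm]

theorem Represents.integral_eq {E : ProjectionMeasure H} {u x : H} {F : ℝ → ℂ}
    (hx : E.Represents u F x) (g : ℝ → ℝ) :
    ∫ t, g t ∂(E.measure x) = ∫ t, g t * ‖F t‖ ^ 2 ∂(E.measure u) := by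
  have hm : AEMeasurable (fun t => ENNReal.ofReal (‖F t‖ ^ 2)) (E.measure u) :=
    ENNReal.measurable_ofReal.comp_aemeasurable (hx.1.1.norm.aemeasurable.pow_const 2)
  rw [hx.measure_eq, integral_withDensity_eq_integral_toReal_smul₀ hm (by simp)]
  apply integral_congr_ae
  filter_upwards with t
  rw [ENNReal.toReal_ofReal (by positivity), smul_eq_mul, mul_comm]

theorem Represents.mem_domain_iff {E : ProjectionMeasure H} {J : H →ₗ.[ℂ] H}
    (hE : IsSpectralFamily J E) {u x : H} {F : ℝ → ℂ} (hx : E.Represents u F x) :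
    x ∈ J.domain ↔ MemLp (fun t : ℝ => (t : ℂ) * F t) 2 (E.measure u) := by
  rw [hE.1, hx.integrable_iff, memLp_two_iff_integrable_sq_norm]
  · apply integrable_congr
    filter_upwards with t
    rw [norm_mul, mul_pow, Complex.norm_real, Real.norm_eq_abs, sq_abs]
  · exact Complex.continuous_ofReal.aestronglyMeasurable.mul hx.1.1

theorem measure_proj_compl (E : ProjectionMeasure H) {B : Set ℝ} (hB : MeasurableSet B) (h : H) :
    E.measure (E.proj B h) Bᶜ = 0 := by
  rw [E.measure_apply hB.compl, E.proj_proj hB.compl hB, Set.compl_inter_self, E.proj_empty]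
  simp

theorem proj_mem_domain {E : ProjectionMeasure H} {J : H →ₗ.[ℂ] H}
    (hE : IsSpectralFamily J E) {B : Set ℝ} (hB : MeasurableSet B) {R : ℝ}
    (hR : ∀ t ∈ B, |t| ≤ R) (h : H) : E.proj B h ∈ J.domain := by
  rw [hE.1]
  refine Integrable.of_bound (by fun_prop) (R ^ 2) ?_
  have : ∀ᵐ t ∂(E.measure (E.proj B h)), t ∈ B := by
    rw [ae_iff]; exact E.measure_proj_compl hB h
  filter_upwards [this] with t ht
  rw [Real.norm_eq_abs, abs_pow]
  exact pow_le_pow_left₀ (abs_nonneg t) (hR t ht) 2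

/-- Pythagoras for `E(B)x` and `c E(B)y`. It makes the cross terms disappear when the quadratic form
is polarized along spectrally orthogonal vectors. -/
theorem measure_add_smul (E : ProjectionMeasure H) {x y : H}
    (hxy : ∀ B, MeasurableSet B → inner ℂ x (E.proj B y) = 0) (c : ℂ) :
    E.measure (x + c • y) = E.measure x + ENNReal.ofReal (‖c‖ ^ 2) • E.measure y := by
  ext B hB
  rw [Measure.add_apply, Measure.smul_apply, E.measure_apply hB, E.measure_apply hB,
    E.measure_apply hB, smul_eq_mul, ← ENNReal.ofReal_mul (by positivity),
    ← ENNReal.ofReal_add (by positivity) (by positivity)]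
  congr 1
  have h : inner ℂ (E.proj B x) (c • E.proj B y) = 0 := by
    rw [inner_smul_right, E.inner_proj_proj hB hB, Set.inter_self, hxy B hB, mul_zero]
  have := norm_add_sq_eq_norm_sq_add_norm_sq_of_inner_eq_zero _ _ h
  rw [map_add, map_smul, pow_two, this, norm_smul]
  ring

/-- The values `c = 1` and `c = i` suffice. This is the polarization device: `IsSpectralFamily`
prescribes only the quadratic form of `J`. -/
theorem eq_zero_of_forall_mul_add_conj_mul {p q : ℂ}
    (h : ∀ c : ℂ, c * p + (starRingEnd ℂ) c * q = 0) : p = 0 := by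
  have h1 := h 1
  have h2 := h Complex.I
  simp only [one_mul, map_one, Complex.conj_I] at h1 h2
  linear_combination (1 / 2) * h1 - Complex.I / 2 * h2 + (p - q) / 2 * Complex.I_sq

theorem Represents.inner_apply_self {E : ProjectionMeasure H} {J : H →ₗ.[ℂ] H}
    (hE : IsSpectralFamily J E) {u x z : H} {F : ℝ → ℂ} (hx : E.Represents u F x)
    (hz : E.Represents u (fun t : ℝ => (t : ℂ) * F t) z) (hxd : x ∈ J.domain) :
    inner ℂ x (J ⟨x, hxd⟩) = inner ℂ x z := by
  rw [hE.2 ⟨x, hxd⟩, hx.inner_eq hz, hx.integral_eq, ← integral_complex_ofReal]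
  apply integral_congr_ae
  filter_upwards with t
  rw [mul_assoc, Complex.mul_conj, Complex.normSq_eq_norm_sq]
  push_cast
  rfl

theorem Represents.inner_apply {E : ProjectionMeasure H} {J : H →ₗ.[ℂ] H}
    (hE : IsSpectralFamily J E) {u x y z w : H} {F G : ℝ → ℂ} (hx : E.Represents u F x)
    (hz : E.Represents u (fun t : ℝ => (t : ℂ) * F t) z) (hy : E.Represents u G y)
    (hw : E.Represents u (fun t : ℝ => (t : ℂ) * G t) w) (hxd : x ∈ J.domain) (hyd : y ∈ J.domain) :
    inner ℂ x (J ⟨y, hyd⟩ - w) = 0 := by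
  apply eq_zero_of_forall_mul_add_conj_mul (q := inner ℂ y (J ⟨x, hxd⟩ - z))
  intro c
  have h1 := hx.inner_apply_self hE hz hxd
  have h2 := hy.inner_apply_self hE hw hyd
  have h3 : inner ℂ (x + c • y) (J ⟨x + c • y, J.domain.add_mem hxd (J.domain.smul_mem c hyd)⟩) =
      inner ℂ (x + c • y) (z + c • w) := by
    apply (hx.add (hy.const_mul c)).inner_apply_self hE
    convert hz.add (hw.const_mul c) using 2
    ring
  have h4 : J ⟨x + c • y, J.domain.add_mem hxd (J.domain.smul_mem c hyd)⟩ =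
      J ⟨x, hxd⟩ + c • J ⟨y, hyd⟩ := by
    rw [← J.map_smul, ← J.map_add]; rfl
  rw [h4] at h3
  simp only [inner_add_left, inner_add_right, inner_smul_left, inner_smul_right, inner_sub_right]
    at h1 h2 h3 ⊢
  linear_combination h3 - h1 - c * (starRingEnd ℂ) c * h2

/-- The spectral measure of `x + cy` is that of `x` plus `|c|²` times that of `y`, so the form at `x
+ cy` has no cross terms; varying `c` separates the two of them. -/
theorem inner_apply_eq_zero {E : ProjectionMeasure H} {J : H →ₗ.[ℂ] H}
    (hE : IsSpectralFamily J E) {x y : H}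
    (hxy : ∀ B, MeasurableSet B → inner ℂ x (E.proj B y) = 0)
    (hxd : x ∈ J.domain) (hyd : y ∈ J.domain) : inner ℂ x (J ⟨y, hyd⟩) = 0 := by
  apply eq_zero_of_forall_mul_add_conj_mul (q := inner ℂ y (J ⟨x, hxd⟩))
  intro c
  have h1 := hE.2 ⟨x, hxd⟩
  have h2 := hE.2 ⟨y, hyd⟩
  have h3 := hE.2 ⟨x + c • y, J.domain.add_mem hxd (J.domain.smul_mem c hyd)⟩
  have h4 : J ⟨x + c • y, J.domain.add_mem hxd (J.domain.smul_mem c hyd)⟩ =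
      J ⟨x, hxd⟩ + c • J ⟨y, hyd⟩ := by
    rw [← J.map_smul, ← J.map_add]; rfl
  have hInt : ∀ z ∈ J.domain, Integrable (fun t : ℝ => t) (E.measure z) := by
    intro z hz
    have h := (memLp_two_iff_integrable_sq (f := fun t : ℝ => t) (by fun_prop)).2 ((hE.1 z).1 hz)
    exact h.integrable (by norm_num)
  simp only at h1 h2 h3
  rw [h4, E.measure_add_smul hxy c, integral_add_measure (hInt x hxd)
    ((hInt y hyd).smul_measure ENNReal.ofReal_ne_top), integral_smul_measure,
    ENNReal.toReal_ofReal (by positivity)] at h3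
  have hc : ((‖c‖ : ℂ)) ^ 2 = c * (starRingEnd ℂ) c := by
    rw [Complex.mul_conj, Complex.normSq_eq_norm_sq]; norm_cast
  simp only [inner_add_left, inner_add_right, inner_smul_left, inner_smul_right, smul_eq_mul,
    Complex.ofReal_add, Complex.ofReal_mul, Complex.ofReal_pow, hc] at h3
  linear_combination h3 - h1 - c * (starRingEnd ℂ) c * h2

theorem Represents.proj {E : ProjectionMeasure H} {u : H} {B : Set ℝ} (hB : MeasurableSet B)
    {x : H} {F : ℝ → ℂ} (hx : E.Represents u F x) :
    E.Represents u (B.indicator F) (E.proj B x) := by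
  obtain ⟨hF, rfl⟩ := hx
  refine ⟨hF.indicator hB, ?_⟩
  rw [proj_integralMap E u hB]
  congr 1
  apply Lp.ext
  filter_upwards [indicatorMul_coeFn (E.measure u) hB hF.toLp, (hF.indicator hB).coeFn_toLp,
    hF.coeFn_toLp] with t h1 h2 h3
  rw [h1, h2]
  by_cases h : t ∈ B <;> simp [h, h3]

theorem Represents.apply {E : ProjectionMeasure H} {J : H →ₗ.[ℂ] H}
    (hE : IsSpectralFamily J E) {u y : H} {G : ℝ → ℂ} (hy : E.Represents u G y)
    (hyd : y ∈ J.domain) : E.Represents u (fun t : ℝ => (t : ℂ) * G t) (J ⟨y, hyd⟩) := by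
  have hmem := (hy.mem_domain_iff hE).1 hyd
  refine ⟨hmem, ?_⟩
  set w := E.integralMap u hmem.toLp with hw
  have hwr : E.Represents u (fun t : ℝ => (t : ℂ) * G t) w := ⟨hmem, rfl⟩
  symm
  rw [← sub_eq_zero]
  set d := J ⟨y, hyd⟩ - w with hd
  -- `K` is the cyclic subspace of `u`, closed because it is an isometric image. The defect `d` is
  -- tested against `E(B)h` with `B` bounded, where `h` splits into a part in `K` and a part
  -- orthogonal to it.
  let K : Submodule ℂ H := LinearMap.range (E.integralMap u).toLinearMap
  have hK : IsClosed (K : Set H) := by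
    have hi : Isometry (E.integralMap u) := by
      apply AddMonoidHomClass.isometry_of_norm
      exact E.norm_integralMap u
    exact hi.isClosedEmbedding.isClosed_range
  have : CompleteSpace K := hK.completeSpace_coe
  have hloc : ∀ B, MeasurableSet B → ∀ R : ℝ, (∀ t ∈ B, |t| ≤ R) → ∀ h : H,
      inner ℂ (E.proj B h) d = 0 := by
    intro B hB R hR h
    obtain ⟨k, hk, z, hz, rfl⟩ := K.exists_add_mem_mem_orthogonal h
    rw [map_add, inner_add_left]
    have hzK : ∀ C, MeasurableSet C → ∀ k ∈ K, inner ℂ (E.proj C z) k = 0 := by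
      rintro C hC _ ⟨F, rfl⟩
      rw [E.inner_proj_left hC]
      apply (Submodule.mem_orthogonal' _ _).1 hz
      rw [ContinuousLinearMap.coe_coe, E.proj_integralMap u hC]
      exact ⟨_, rfl⟩
    have h2 : inner ℂ (E.proj B z) d = 0 := by
      rw [hd, inner_sub_right, hzK B hB w ⟨_, rfl⟩, sub_zero]
      apply inner_apply_eq_zero hE _ (proj_mem_domain hE hB hR z)
      intro C hC
      apply hzK B hB
      obtain ⟨hG, rfl⟩ := hy
      rw [E.proj_integralMap u hC]
      exact ⟨_, rfl⟩
    -- Inside `K` both vectors are represented by functions, and the polarized quadratic form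
    -- identifies the pairing.
    have h1 : inner ℂ (E.proj B k) d = 0 := by
      obtain ⟨F, rfl⟩ := hk
      have hx := (E.represents_integralMap u F).proj hB
      have hxd := proj_mem_domain hE hB hR (E.integralMap u F)
      exact hx.inner_apply hE (z := E.integralMap u ((hx.mem_domain_iff hE).1 hxd).toLp) ⟨_, rfl⟩
        hy hwr hxd hyd
    rw [h1, h2, add_zero]
  -- The bounded layers `i ≤ |t| < i + 1` partition the line; summing over them turns the local
  -- orthogonality into `⟨d, d⟩ = 0`.
  have hmeas : ∀ i : ℕ, MeasurableSet {t : ℝ | ⌊|t|⌋₊ = i} := fun i =>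
    (Nat.measurable_floor.comp (measurable_norm (α := ℝ))) (measurableSet_singleton i)
  have hsum := E.hasSum_proj (fun i => {t : ℝ | ⌊|t|⌋₊ = i}) hmeas
    (by
      intro i j hij
      rw [Function.onFun, Set.disjoint_left]
      intro t h1 h2
      exact hij (h1.symm.trans h2)) d
  have huniv : (⋃ i : ℕ, {t : ℝ | ⌊|t|⌋₊ = i}) = Set.univ := by
    ext t; simp
  rw [huniv, E.proj_univ] at hsum
  have hin := (innerSL ℂ d).hasSum hsum
  have hz : (fun i : ℕ => (innerSL ℂ d) (E.proj {t : ℝ | ⌊|t|⌋₊ = i} d)) = fun _ => 0 := by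
    funext i
    rw [innerSL_apply_apply, ← inner_conj_symm, hloc _ (hmeas i) (i + 1), map_zero]
    intro t ht
    have := Nat.lt_floor_add_one |t|
    rw [Set.mem_ofPred_eq] at ht
    rw [ht] at this
    exact this.le
  have hin' : HasSum (fun _ : ℕ => (0 : ℂ)) (inner ℂ d d) := by
    rw [← hz]; exact hin
  exact inner_self_eq_zero.1 (hin'.unique hasSum_zero)

end ProjectionMeasure

/-! ### Orthonormal polynomials and Parseval's identity -/

/-- The vector `e_n` of the standard basis. -/
def basisVec (n : ℕ) : EllTwo := lp.single 2 n (1 : ℂ)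

theorem basisVec_apply (n m : ℕ) : basisVec n m = if m = n then 1 else 0 := by
  rw [basisVec, lp.single_apply, Pi.single_apply]

theorem inner_basisVec (n : ℕ) (h : EllTwo) : inner ℂ (basisVec n) h = h n := by
  rw [basisVec, lp.inner_single_left]; simp

theorem basisVec_mem (n : ℕ) : basisVec n ∈ finiteVectors := by
  refine (Set.finite_singleton n).subset ?_
  intro m hm
  by_contra h
  apply hm
  rw [basisVec_apply]
  exact if_neg h

theorem basisVec_mem_domain {a b : ℕ → ℝ} {J : EllTwo →ₗ.[ℂ] EllTwo} (hJ : jacobiMin a b ≤ J)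
    (n : ℕ) : basisVec n ∈ J.domain :=
  hJ.1 (basisVec_mem n)

theorem apply_basisVec {a b : ℕ → ℝ} {J : EllTwo →ₗ.[ℂ] EllTwo} (hJ : jacobiMin a b ≤ J)
    (n : ℕ) : J ⟨basisVec n, basisVec_mem_domain hJ n⟩ =
      (if n = 0 then (0 : EllTwo) else (a (n - 1) : ℂ) • basisVec (n - 1)) +
        (b n : ℂ) • basisVec n + (a n : ℂ) • basisVec (n + 1) := by
  have h := hJ.2 (x := ⟨basisVec n, basisVec_mem n⟩)
    (y := ⟨basisVec n, basisVec_mem_domain hJ n⟩) rfl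
  rw [← h]
  ext m
  change jacobiExpr a b (basisVec n) m = _
  rcases n with _ | n
  · simp only [jacobiExpr, basisVec_apply, lp.coeFn_add, lp.coeFn_smul, Pi.add_apply,
      Pi.smul_apply, smul_eq_mul, if_true, lp.coeFn_zero, Pi.zero_apply]
    rcases m with _ | _ | m <;> simp
  · simp only [jacobiExpr, basisVec_apply, lp.coeFn_add, lp.coeFn_smul, Pi.add_apply,
      Pi.smul_apply, smul_eq_mul, Nat.add_sub_cancel, if_neg (Nat.succ_ne_zero n)]
    rcases m with _ | m
    · have h1 : (0 : ℕ) ≠ n + 1 := by omega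
      have h2 : (0 : ℕ) ≠ n + 1 + 1 := by omega
      by_cases h3 : n = 0
      · subst h3; simp
      · simp [h3, Ne.symm h3]
    · simp only [if_neg (Nat.succ_ne_zero m), Nat.add_sub_cancel, Nat.add_right_cancel_iff]
      by_cases h1 : m = n + 1
      · subst h1
        have h2 : ¬ (n + 1 + 1 = n) := by omega
        simp [h2]
      · by_cases h2 : m = n
        · subst h2; simp
        · by_cases h3 : m + 1 = n
          · subst h3
            have h4 : ¬ (m = m + 1 + 1) := by omega
            simp [h4]
          · simp [h1, h2, h3]

/-- The orthonormal polynomial, as a complex-valued function on the line. -/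
def polyFun (a b : ℕ → ℝ) (n : ℕ) (t : ℝ) : ℂ := (((jacobiPoly a b n).eval t : ℝ) : ℂ)

open ProjectionMeasure in
theorem represents_polyFun {a b : ℕ → ℝ} (ha : ∀ n, 0 < a n)
    {J : EllTwo →ₗ.[ℂ] EllTwo} (hJ : jacobiMin a b ≤ J)
    {E : ProjectionMeasure EllTwo} (hE : IsSpectralFamily J E) (n : ℕ) :
    E.Represents basisZero (polyFun a b n) (basisVec n) := by
  -- Solves `J e_n = q + b_n e_n + a_n e_{n+1}` for `e_{n+1}`. The separate vector `q` covers the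
  -- convention `a_{-1} = 0` at `n = 0`.
  have step : ∀ (n : ℕ) (q : EllTwo) (F Q : ℝ → ℂ),
      q = (if n = 0 then (0 : EllTwo) else (a (n - 1) : ℂ) • basisVec (n - 1)) →
      E.Represents basisZero Q q → E.Represents basisZero F (basisVec n) →
      E.Represents basisZero (fun t => (a n : ℂ)⁻¹ * ((t : ℂ) * F t + (-1 * Q t + (-b n) * F t)))
        (basisVec (n + 1)) := by
    intro n q F Q hq hQ hF
    have h := ((hF.apply hE (basisVec_mem_domain hJ n)).add
      ((hQ.const_mul (-1)).add (hF.const_mul (-b n)))).const_mul (a n : ℂ)⁻¹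
    convert h using 1
    rw [apply_basisVec hJ, ← hq, eq_inv_smul_iff₀ (by exact_mod_cast (ha n).ne')]
    module
  induction n using Nat.twoStepInduction with
  | zero =>
    change E.Represents basisZero (polyFun a b 0) basisZero
    convert E.represents_one basisZero using 1
    funext t
    simp [polyFun, jacobiPoly]
  | one =>
    convert step 0 0 (fun _ => 1) (fun _ => 0) (by simp) (E.represents_zero _)
      (E.represents_one basisZero) using 1
    funext t
    simp [polyFun, jacobiPoly, sub_eq_add_neg]
  | more n h1 h2 =>
    convert step (n + 1) _ (polyFun a b (n + 1)) _ (by simp) (h1.const_mul (a n)) h2 using 1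
    funext t
    simp only [polyFun, jacobiPoly, Polynomial.eval_mul, Polynomial.eval_sub, Polynomial.eval_C,
      Polynomial.eval_X]
    push_cast
    ring

/-- Parseval's identity for the expansion in the orthonormal polynomials. -/
theorem hasSum_sq_norm_integral_polyFun {a b : ℕ → ℝ} (ha : ∀ n, 0 < a n)
    {J : EllTwo →ₗ.[ℂ] EllTwo} (hJ : jacobiMin a b ≤ J)
    {E : ProjectionMeasure EllTwo} (hE : IsSpectralFamily J E) {F : ℝ → ℂ}
    (hF : MemLp F 2 (E.measure basisZero)) :
    HasSum (fun n => ‖∫ t, F t * polyFun a b n t ∂(E.measure basisZero)‖ ^ 2)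
      (∫ t, ‖F t‖ ^ 2 ∂(E.measure basisZero)) := by
  set h : EllTwo := E.integralMap basisZero hF.toLp with hh
  have hr : E.Represents basisZero F h := ⟨hF, rfl⟩
  -- Since `P_n` is real, the coordinates of `(∫ F dE) e₀` are its polynomial coefficients; Parseval
  -- is then just the norm formula of `ℓ²`.
  have h1 : ∀ n, h n = ∫ t, F t * polyFun a b n t ∂(E.measure basisZero) := by
    intro n
    rw [← inner_basisVec, (represents_polyFun ha hJ hE n).inner_eq hr]
    simp [polyFun]
  have h2 : inner ℂ h h = ((∫ t, ‖F t‖ ^ 2 ∂(E.measure basisZero) : ℝ) : ℂ) := by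
    rw [hr.inner_eq hr, ← integral_complex_ofReal]
    congr 1
    funext t
    rw [Complex.mul_conj, Complex.normSq_eq_norm_sq]
  have h3 := lp.hasSum_inner (𝕜 := ℂ) h h
  rw [h2] at h3
  have h4 : (fun n => inner ℂ (h n) (h n)) =
      fun n => ((‖∫ t, F t * polyFun a b n t ∂(E.measure basisZero)‖ ^ 2 : ℝ) : ℂ) := by
    funext n
    rw [inner_self_eq_norm_sq_to_K, h1]
    norm_cast
  rw [h4] at h3
  exact Complex.hasSum_ofReal.1 h3

/-- Parseval's identity for functions supported where the spectral measure has a density. -/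
theorem hasSum_sq_norm_integral_density {a b : ℕ → ℝ} (ha : ∀ n, 0 < a n)
    {J : EllTwo →ₗ.[ℂ] EllTwo} (hJ : jacobiMin a b ≤ J)
    {E : ProjectionMeasure EllTwo} (hE : IsSpectralFamily J E) {Λ : Set ℝ} (hΛ : IsOpen Λ)
    {τ : ℝ → ℝ} (hτc : ContinuousOn τ Λ) (hτpos : ∀ l ∈ Λ, 0 < τ l)
    (hτ : (E.measure basisZero).restrict Λ =
      (volume.restrict Λ).withDensity (fun l => ENNReal.ofReal (τ l)))
    {F : ℝ → ℂ} (hF : Continuous F) {C : ℝ} (hC : ∀ t, ‖F t‖ ≤ C) (hs : ∀ t ∉ Λ, F t = 0) :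
    HasSum (fun n => ‖∫ t, (τ t : ℂ) * (F t * polyFun a b n t)‖ ^ 2) (∫ t, τ t * ‖F t‖ ^ 2) := by
  have hmem : MemLp F 2 (E.measure basisZero) :=
    MemLp.of_bound hF.aestronglyMeasurable C (ae_of_all _ hC)
  have hm : AEMeasurable (fun l => ENNReal.ofReal (τ l)) (volume.restrict Λ) :=
    ENNReal.measurable_ofReal.comp_aemeasurable (hτc.aemeasurable hΛ.measurableSet)
  have key : ∀ {V : Type} [NormedAddCommGroup V] [NormedSpace ℝ V] (G : ℝ → V),
      (∀ t ∉ Λ, G t = 0) → ∫ t, G t ∂(E.measure basisZero) = ∫ t, τ t • G t := by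
    intro V _ _ G hG
    rw [← setIntegral_eq_integral_of_forall_compl_eq_zero (s := Λ) hG, hτ,
      integral_withDensity_eq_integral_toReal_smul₀ hm (by simp),
      ← setIntegral_eq_integral_of_forall_compl_eq_zero (s := Λ)
        (f := fun t => τ t • G t) (fun t ht => by simp [hG t ht])]
    apply setIntegral_congr_fun hΛ.measurableSet
    intro t ht
    simp only
    rw [ENNReal.toReal_ofReal (hτpos t ht).le]
  have h := hasSum_sq_norm_integral_polyFun ha hJ hE hmem
  rw [key _ (fun t ht => by simp [hs t ht])] at h
  simp only [smul_eq_mul] at h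
  convert h using 1
  funext n
  rw [key _ (fun t ht => by simp [hs t ht])]
  simp

/-! ### Telescoping sums of window masses -/

theorem exists_first_index_gt {x : ℕ → ℝ} (hx : Tendsto x atTop atTop) (N : ℕ) (X : ℝ) :
    ∃ N₁, N ≤ N₁ ∧ X < x N₁ ∧ ∀ n, N ≤ n → n < N₁ → x n ≤ X := by
  classical
  have h : ∃ n, N ≤ n ∧ X < x n :=
    ((eventually_ge_atTop N).and (hx.eventually_gt_atTop X)).exists
  refine ⟨Nat.find h, (Nat.find_spec h).1, (Nat.find_spec h).2, fun n hn hlt => ?_⟩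
  by_contra hcon
  exact Nat.find_min h hlt ⟨hn, not_le.1 hcon⟩

theorem tendsto_affine_div_atTop (p q : ℝ) :
    Tendsto (fun S : ℝ => (p * S + q) / S) atTop (𝓝 p) := by
  have h : Tendsto (fun S : ℝ => p + q / S) atTop (𝓝 (p + 0)) :=
    tendsto_const_nhds.add (tendsto_const_nhds.div_atTop tendsto_id)
  rw [add_zero] at h
  refine h.congr' ?_
  filter_upwards [eventually_gt_atTop 0] with S hS
  field_simp

theorem le_of_eventually_affine_le {p q p' q' : ℝ}
    (h : ∀ᶠ S : ℝ in atTop, p * S + q ≤ p' * S + q') : p ≤ p' := by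
  refine le_of_tendsto_of_tendsto (tendsto_affine_div_atTop p q) (tendsto_affine_div_atTop p' q') ?_
  filter_upwards [h, eventually_gt_atTop 0] with S hS h0
  exact div_le_div_of_nonneg_right hS h0.le

/-- Indices with `x_n ≤ 2πS/M` each contribute about `2G v_n² ≥ 2Gs (x_{n+1} - x_n)`. Telescoping up
to the first index beyond the threshold gives slope `2Gs · 2π/M` in `S`, against at most `2Q`.
Overshooting the threshold only helps here, so no condition on the ratio of steps is needed. -/
theorem le_of_summed_window_lower_bound {x v c : ℕ → ℝ} {W : ℕ → ℝ → ℝ} {G Q M s C : ℝ}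
    (hG : 0 < G) (hM : 0 < M) (hs : 0 < s)
    (hxt : Tendsto x atTop atTop) (hc : Tendsto c atTop (𝓝 (2 * G)))
    (hW : ∀ᶠ n in atTop, ∀ S > 0, M * x n ≤ 2 * Real.pi * S → c n - C / S ≤ W n S)
    (hsum : ∀ δ > 0, ∃ D, ∀ S > 0, ∀ F : Finset ℕ,
      ∑ n ∈ F, v n ^ 2 * W n S ≤ (1 + δ) * (2 * S * Q) + D)
    (hv : ∀ᶠ n in atTop, s * (x (n + 1) - x n) ≤ v n ^ 2)
    (hxl : ∀ᶠ n in atTop, x n < x (n + 1)) :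
    2 * Real.pi * s * G ≤ M * Q := by
  have hpi := Real.pi_pos
  have key : ∀ ε ∈ Set.Ioo 0 (2 * G),
      s * (2 * Real.pi / M) * (2 * G - ε) ≤ (1 + ε) * (2 * Q) := by
    rintro ε ⟨hε, hεG⟩
    obtain ⟨D, hD⟩ := hsum ε hε
    obtain ⟨N, hN⟩ := eventually_atTop.1
      (((hc.eventually (lt_mem_nhds (show 2 * G - ε < 2 * G by linarith))).and hW).and
        (hv.and hxl))
    apply le_of_eventually_affine_le
      -- Constant part of `s (2πS/M - x_N)(2G - ε - C/S)`; its `1/S` term is bounded using `S > 1`.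
      (q := - (s * (2 * Real.pi / M) * C) - s * x N * (2 * G - ε) - s * |x N| * |C|) (q' := D)
    filter_upwards [eventually_gt_atTop 1, eventually_ge_atTop (M * x N / (2 * Real.pi)),
      eventually_ge_atTop (C / (2 * G - ε))] with S hS1 hSN hSC
    have hS : 0 < S := by linarith
    obtain ⟨N₁, hN₁, hgt, hle⟩ := exists_first_index_gt hxt N (2 * Real.pi * S / M)
    have hfac : 0 ≤ 2 * G - ε - C / S := by
      rw [div_le_iff₀ (by linarith)] at hSC
      rw [sub_nonneg, div_le_iff₀ hS]
      linarith
    have h1 : ∑ n ∈ Finset.Ico N N₁, s * (x (n + 1) - x n) * (2 * G - ε - C / S) ≤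
        ∑ n ∈ Finset.Ico N N₁, v n ^ 2 * W n S := by
      refine Finset.sum_le_sum fun n hn => ?_
      rw [Finset.mem_Ico] at hn
      obtain ⟨⟨h2, h3⟩, h4, h5⟩ := hN n hn.1
      refine mul_le_mul h4 ?_ hfac (sq_nonneg _)
      have := h3 S hS (by
        have := hle n hn.1 hn.2
        rw [le_div_iff₀ hM] at this
        linarith)
      linarith
    rw [← Finset.sum_mul, ← Finset.mul_sum, Finset.sum_Ico_sub x hN₁] at h1
    have h2 := hD S hS (Finset.Ico N N₁)
    have h3 : s * (2 * Real.pi * S / M - x N) * (2 * G - ε - C / S) ≤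
        s * (x N₁ - x N) * (2 * G - ε - C / S) := by
      gcongr
    have h4 : s * (2 * Real.pi * S / M - x N) * (2 * G - ε - C / S) =
        s * (2 * Real.pi / M) * (2 * G - ε) * S - s * (2 * Real.pi / M) * C
          - s * x N * (2 * G - ε) + s * (x N * C) / S := by
      field_simp
      ring
    have h5 : - (s * |x N| * |C|) ≤ s * (x N * C) / S := by
      have h6 : |s * (x N * C) / S| ≤ s * |x N| * |C| := by
        rw [abs_div, abs_mul, abs_mul, abs_of_pos hs, abs_of_pos hS, ← mul_assoc]
        exact div_le_self (by positivity) hS1.le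
      exact (abs_le.1 h6).1
    linarith
  have hlim : s * (2 * Real.pi / M) * (2 * G - 0) ≤ (1 + 0) * (2 * Q) := by
    refine le_of_tendsto_of_tendsto (b := 𝓝[>] (0 : ℝ))
      (f := fun ε => s * (2 * Real.pi / M) * (2 * G - ε)) (g := fun ε => (1 + ε) * (2 * Q)) ?_ ?_ ?_
    · exact (Continuous.tendsto (by fun_prop) _).mono_left nhdsWithin_le_nhds
    · exact (Continuous.tendsto (by fun_prop) _).mono_left nhdsWithin_le_nhds
    · filter_upwards [Ioo_mem_nhdsGT (show (0 : ℝ) < 2 * G by linarith)] with ε hε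
      exact key ε hε
  have h : s * (2 * Real.pi / M) * (2 * G - 0) = 2 * (2 * Real.pi * s * G) / M := by
    field_simp
    ring
  rw [h, div_le_iff₀ hM] at hlim
  linarith

/-- The sum splits in three: finitely many initial terms bounded uniformly in `S`; indices up to the
threshold `Y = 2πS/m`, which telescope to the main term; and a tail controlled by `CS/x_n²`. The
ratio condition limits the overshoot past `Y` and makes the tail telescope. -/
theorem le_of_summed_window_upper_bound {x v c : ℕ → ℝ} {W : ℕ → ℝ → ℝ} {G Q m s C : ℝ}
    (hG : 0 < G) (hm : 0 < m) (hs : 0 < s) (hC : 0 ≤ C)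
    (hxt : Tendsto x atTop atTop) (hc : Tendsto c atTop (𝓝 (2 * G)))
    (hW0 : ∀ n S, 0 < S → 0 ≤ W n S) (hWc : ∀ n S, 0 < S → W n S ≤ c n)
    (hW : ∀ᶠ n in atTop, ∀ S > 0, 2 * Real.pi * S ≤ m * x n → W n S ≤ C * S / x n ^ 2)
    (hsum : ∀ δ > 0, ∃ D, ∀ S > 0, ∀ U, (∀ N, ∑ n ∈ Finset.range N, v n ^ 2 * W n S ≤ U) →
      2 * S * Q ≤ (1 + δ) * U + D)
    (hv : ∀ᶠ n in atTop, v n ^ 2 ≤ s * (x (n + 1) - x n))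
    (hxl : ∀ᶠ n in atTop, x n < x (n + 1))
    (hratio : Tendsto (fun n => (x (n + 1) - x n) / x n) atTop (𝓝 0)) :
    m * Q ≤ 2 * Real.pi * s * G := by
  have hpi := Real.pi_pos
  have key : ∀ ε > 0,
      2 * Q ≤ (1 + ε) * (s * (2 * G + ε) * ((1 + ε) * (2 * Real.pi / m))) := by
    intro ε hε
    obtain ⟨D, hD⟩ := hsum ε hε
    obtain ⟨N, hN⟩ := eventually_atTop.1
      ((((hc.eventually (gt_mem_nhds (show 2 * G < 2 * G + ε by linarith))).and hW).and
        (hv.and hxl)).and ((hratio.eventually (gt_mem_nhds hε)).and (hxt.eventually_gt_atTop 0)))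
    set A₀ := ∑ n ∈ Finset.range N, v n ^ 2 * c n with hA₀
    apply le_of_eventually_affine_le (q := 0)
      (q' := (1 + ε) * (A₀ + s * C * (1 + ε) * m / (2 * Real.pi)) + D)
    filter_upwards [eventually_gt_atTop 0, eventually_ge_atTop (m * x N / (2 * Real.pi))]
      with S hS hSN
    set Y := 2 * Real.pi * S / m with hY
    have hY0 : 0 < Y := by positivity
    have hYN : x N ≤ Y := by
      rw [hY, le_div_iff₀ hm]
      rw [div_le_iff₀ (by positivity)] at hSN
      linarith
    obtain ⟨N₁, hN₁, hgt, hle⟩ := exists_first_index_gt hxt N Y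
    have hstep : ∀ n, N ≤ n → x (n + 1) ≤ (1 + ε) * x n := by
      intro n hn
      obtain ⟨-, h1, h2⟩ := hN n hn
      rw [div_lt_iff₀ h2] at h1
      linarith
    have hx1 : x N₁ ≤ (1 + ε) * Y := by
      -- Unless the first index beyond `Y` is `N` itself, its predecessor is at most `Y` and one
      -- step multiplies by at most `1 + ε`.
      rcases Nat.exists_eq_add_of_le hN₁ with ⟨k, rfl⟩
      rcases k with _ | k
      · rw [add_zero] at hgt; linarith
      · calc x (N + (k + 1)) ≤ (1 + ε) * x (N + k) := hstep (N + k) (by omega)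
          _ ≤ (1 + ε) * Y := by
            have := hle (N + k) (by omega) (by omega)
            gcongr
    have hU : ∀ K, ∑ n ∈ Finset.range K, v n ^ 2 * W n S ≤
        A₀ + s * (2 * G + ε) * ((1 + ε) * Y) + s * C * (1 + ε) * m / (2 * Real.pi) := by
      intro K
      have h1 : ∑ n ∈ Finset.range K, v n ^ 2 * W n S ≤
          ∑ n ∈ Finset.range (max K N₁), v n ^ 2 * W n S := by
        refine Finset.sum_le_sum_of_subset_of_nonneg
          (Finset.range_mono (le_max_left _ _)) fun n _ _ => ?_
        exact mul_nonneg (sq_nonneg _) (hW0 n S hS)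
      have h2 : ∑ n ∈ Finset.range N, v n ^ 2 * W n S ≤ A₀ :=
        Finset.sum_le_sum fun n _ => mul_le_mul_of_nonneg_left (hWc n S hS) (sq_nonneg _)
      have h3 : ∑ n ∈ Finset.Ico N N₁, v n ^ 2 * W n S ≤ s * (2 * G + ε) * ((1 + ε) * Y) := by
        have h4 : ∑ n ∈ Finset.Ico N N₁, v n ^ 2 * W n S ≤
            ∑ n ∈ Finset.Ico N N₁, s * (x (n + 1) - x n) * (2 * G + ε) := by
          refine Finset.sum_le_sum fun n hn => ?_
          rw [Finset.mem_Ico] at hn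
          obtain ⟨⟨⟨h5, -⟩, h6, h7⟩, -⟩ := hN n hn.1
          exact mul_le_mul h6 ((hWc n S hS).trans h5.le) (hW0 n S hS)
            (mul_nonneg hs.le (sub_nonneg.2 h7.le))
        rw [← Finset.sum_mul, ← Finset.mul_sum, Finset.sum_Ico_sub x hN₁] at h4
        refine h4.trans ?_
        have h8 : x N₁ - x N ≤ (1 + ε) * Y := by linarith [(hN N le_rfl).2.2]
        calc s * (x N₁ - x N) * (2 * G + ε) = s * (2 * G + ε) * (x N₁ - x N) := by ring
          _ ≤ _ := by gcongr
      have h4 : ∑ n ∈ Finset.Ico N₁ (max K N₁), v n ^ 2 * W n S ≤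
          s * C * (1 + ε) * m / (2 * Real.pi) := by
        have h5 : ∑ n ∈ Finset.Ico N₁ (max K N₁), v n ^ 2 * W n S ≤
            ∑ n ∈ Finset.Ico N₁ (max K N₁),
              s * C * S * (1 + ε) * (-(x (n + 1))⁻¹ - -(x n)⁻¹) := by
          refine Finset.sum_le_sum fun n hn => ?_
          rw [Finset.mem_Ico] at hn
          have hNn : N ≤ n := hN₁.trans hn.1
          obtain ⟨⟨⟨-, h5⟩, h6, h7⟩, -, h8⟩ := hN n hNn
          have hmono : x N₁ ≤ x n := by
            obtain ⟨k, rfl⟩ := Nat.exists_eq_add_of_le hn.1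
            clear hn h5 h6 h7 h8 hNn
            induction k with
            | zero => simp
            | succ k ih => exact ih.trans (hN (N₁ + k) (by omega)).1.2.2.le
          have h9 : W n S ≤ C * S / x n ^ 2 := by
            apply h5 S hS
            have : Y ≤ x n := hgt.le.trans hmono
            rw [hY, div_le_iff₀ hm] at this
            linarith
          have h10 : 0 < x (n + 1) := h8.trans h7
          -- Trading one `x_n` for `x_{n+1}` makes `(x_{n+1} - x_n)/(x_n x_{n+1})` a difference of
          -- reciprocals; the tail is then `O(S/Y) = O(1)`.
          have h11 : C * S / x n ^ 2 ≤ C * S * ((1 + ε) / (x n * x (n + 1))) := by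
            rw [div_eq_mul_inv]
            refine mul_le_mul_of_nonneg_left ?_ (by positivity)
            rw [inv_eq_one_div, div_le_div_iff₀ (by positivity) (by positivity)]
            have := mul_le_mul_of_nonneg_left (hstep n hNn) h8.le
            linarith
          calc v n ^ 2 * W n S ≤ s * (x (n + 1) - x n) * (C * S * ((1 + ε) / (x n * x (n + 1)))) :=
                mul_le_mul h6 (h9.trans h11) (hW0 n S hS) (mul_nonneg hs.le (sub_nonneg.2 h7.le))
            _ = _ := by
              field_simp
              ring
        rw [← Finset.mul_sum, Finset.sum_Ico_sub (fun n => -(x n)⁻¹) (le_max_right K N₁)] at h5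
        refine h5.trans ?_
        have h6 : 0 < x (max K N₁) := (hN _ (hN₁.trans (le_max_right _ _))).2.2
        have h7 : -(x (max K N₁))⁻¹ - -(x N₁)⁻¹ ≤ Y⁻¹ := by
          have h8 : (x N₁)⁻¹ ≤ Y⁻¹ := inv_anti₀ hY0 hgt.le
          have h9 : 0 < (x (max K N₁))⁻¹ := inv_pos.2 h6
          linarith
        calc _ ≤ s * C * S * (1 + ε) * Y⁻¹ := by
              refine mul_le_mul_of_nonneg_left h7 (by positivity)
          _ = _ := by
            rw [hY]
            field_simp
      rw [Finset.range_eq_Ico] at h1 h2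
      rw [Finset.range_eq_Ico, ← Finset.sum_Ico_consecutive _ (Nat.zero_le N)
        (hN₁.trans (le_max_right K N₁)),
        ← Finset.sum_Ico_consecutive _ hN₁ (le_max_right K N₁)] at h1
      rw [Finset.range_eq_Ico]
      linarith
    have h := hD S hS _ hU
    rw [hY] at h
    calc 2 * Q * S + 0 = 2 * S * Q := by ring
      _ ≤ _ := h
      _ = _ := by ring
  have hlim : 2 * Q ≤ (1 + 0) * (s * (2 * G + 0) * ((1 + 0) * (2 * Real.pi / m))) := by
    refine ge_of_tendsto (x := 𝓝[>] (0 : ℝ))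
      (f := fun ε => (1 + ε) * (s * (2 * G + ε) * ((1 + ε) * (2 * Real.pi / m)))) ?_ ?_
    · exact (Continuous.tendsto (by fun_prop) _).mono_left nhdsWithin_le_nhds
    · filter_upwards [self_mem_nhdsWithin] with ε hε
      exact key ε hε
  have h : (1 + 0) * (s * (2 * G + 0) * ((1 + 0) * (2 * Real.pi / m))) =
      2 * (2 * Real.pi * s * G) / m := by
    field_simp
    ring
  rw [h, le_div_iff₀ hm] at hlim
  linarith

/-! ### Parseval's identity integrated over a window -/

theorem norm_add_sq_le_weighted {V : Type*} [SeminormedAddCommGroup V] (y z : V) {δ : ℝ}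
    (hδ : 0 < δ) : ‖y + z‖ ^ 2 ≤ (1 + δ) * ‖y‖ ^ 2 + (1 + δ⁻¹) * ‖z‖ ^ 2 := by
  have h1 : ‖y + z‖ ^ 2 ≤ (‖y‖ + ‖z‖) ^ 2 := by
    gcongr; exact norm_add_le y z
  have h2 : 0 ≤ δ⁻¹ * (δ * ‖y‖ - ‖z‖) ^ 2 := by positivity
  have h3 : δ⁻¹ * (δ * ‖y‖ - ‖z‖) ^ 2 = δ * ‖y‖ ^ 2 - 2 * ‖y‖ * ‖z‖ + δ⁻¹ * ‖z‖ ^ 2 := by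
    field_simp
    ring
  nlinarith

/-- The perturbation is integrated over the whole line, so its cost does not depend on `S`, while
the main part loses only a factor `1 + δ`. -/
theorem sum_window_norm_sq_le {p r : ℕ → ℝ → ℂ} (hp : ∀ n, Continuous (p n))
    (hr : ∀ n, Continuous (r n)) {C' : ℝ}
    (hri : ∀ n, Integrable fun s => ‖r n s‖ ^ 2)
    (hrC : ∀ F : Finset ℕ, ∑ n ∈ F, ∫ s, ‖r n s‖ ^ 2 ≤ C') {δ S : ℝ} (hδ : 0 < δ) (hS : 0 < S)
    (F : Finset ℕ) :
    ∑ n ∈ F, ∫ s in (-S)..S, ‖p n s + r n s‖ ^ 2 ≤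
      (1 + δ) * (∑ n ∈ F, ∫ s in (-S)..S, ‖p n s‖ ^ 2) + (1 + δ⁻¹) * C' := by
  have h1 : ∀ n, ∫ s in (-S)..S, ‖p n s + r n s‖ ^ 2 ≤
      (1 + δ) * (∫ s in (-S)..S, ‖p n s‖ ^ 2) + (1 + δ⁻¹) * ∫ s, ‖r n s‖ ^ 2 := by
    intro n
    have hpc := hp n
    have hrc := hr n
    have h2 : ∫ s in (-S)..S, ‖r n s‖ ^ 2 ≤ ∫ s, ‖r n s‖ ^ 2 := by
      rw [intervalIntegral.integral_of_le (by linarith)]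
      exact setIntegral_le_integral (hri n) (ae_of_all _ fun s => by positivity)
    calc ∫ s in (-S)..S, ‖p n s + r n s‖ ^ 2
        ≤ ∫ s in (-S)..S, ((1 + δ) * ‖p n s‖ ^ 2 + (1 + δ⁻¹) * ‖r n s‖ ^ 2) := by
          apply intervalIntegral.integral_mono_on (by linarith)
          · exact (by fun_prop : Continuous _).intervalIntegrable _ _
          · exact (by fun_prop : Continuous _).intervalIntegrable _ _
          · intro s _
            exact norm_add_sq_le_weighted _ _ hδ
      _ = (1 + δ) * (∫ s in (-S)..S, ‖p n s‖ ^ 2) + (1 + δ⁻¹) * ∫ s in (-S)..S, ‖r n s‖ ^ 2 := by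
          rw [intervalIntegral.integral_add, intervalIntegral.integral_const_mul,
            intervalIntegral.integral_const_mul]
          · exact (by fun_prop : Continuous _).intervalIntegrable _ _
          · exact (by fun_prop : Continuous _).intervalIntegrable _ _
      _ ≤ _ := by gcongr
  calc _ ≤ ∑ n ∈ F, ((1 + δ) * (∫ s in (-S)..S, ‖p n s‖ ^ 2) + (1 + δ⁻¹) * ∫ s, ‖r n s‖ ^ 2) :=
        Finset.sum_le_sum fun n _ => h1 n
    _ = (1 + δ) * (∑ n ∈ F, ∫ s in (-S)..S, ‖p n s‖ ^ 2) +
        (1 + δ⁻¹) * ∑ n ∈ F, ∫ s, ‖r n s‖ ^ 2 := by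
        rw [Finset.sum_add_distrib, Finset.mul_sum, Finset.mul_sum]
    _ ≤ _ := by
      have := hrC F
      gcongr

theorem sum_window_le_of_hasSum {p : ℕ → ℝ → ℂ} (hp : ∀ n, Continuous (p n)) {Q : ℝ}
    (hsum : ∀ s, HasSum (fun n => ‖p n s‖ ^ 2) Q) {S : ℝ} (hS : 0 < S) (F : Finset ℕ) :
    ∑ n ∈ F, ∫ s in (-S)..S, ‖p n s‖ ^ 2 ≤ 2 * S * Q := by
  rw [← intervalIntegral.integral_finsetSum
    fun n _ => (by have := hp n; fun_prop : Continuous _).intervalIntegrable _ _]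
  calc _ ≤ ∫ s in (-S)..S, Q := by
        apply intervalIntegral.integral_mono_on (by linarith)
        · exact (by fun_prop : Continuous _).intervalIntegrable _ _
        · exact continuous_const.intervalIntegrable _ _
        · intro s _
          exact sum_le_hasSum _ (fun _ _ => by positivity) (hsum s)
    _ = _ := by
      rw [intervalIntegral.integral_const, smul_eq_mul]; ring

theorem le_of_forall_sum_window_le {p : ℕ → ℝ → ℂ} (hp : ∀ n, Continuous (p n)) {Q : ℝ}
    (hsum : ∀ s, HasSum (fun n => ‖p n s‖ ^ 2) Q) {S U : ℝ}
    (hU : ∀ N, ∑ n ∈ Finset.range N, ∫ s in (-S)..S, ‖p n s‖ ^ 2 ≤ U) : 2 * S * Q ≤ U := by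
  have hlim : Tendsto (fun N => ∫ s in (-S)..S, ∑ n ∈ Finset.range N, ‖p n s‖ ^ 2) atTop
      (𝓝 (∫ s in (-S)..S, Q)) := by
    apply intervalIntegral.tendsto_integral_filter_of_dominated_convergence (fun _ => Q)
    · filter_upwards with N
      exact (by fun_prop : Continuous _).aestronglyMeasurable
    · filter_upwards with N
      filter_upwards with s _
      rw [Real.norm_of_nonneg (Finset.sum_nonneg fun _ _ => by positivity)]
      exact sum_le_hasSum _ (fun _ _ => by positivity) (hsum s)
    · exact continuous_const.intervalIntegrable _ _
    · filter_upwards with s _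
      exact (hsum s).tendsto_sum_nat
  rw [intervalIntegral.integral_const, smul_eq_mul] at hlim
  have := le_of_tendsto' hlim (fun N => by
    rw [intervalIntegral.integral_finsetSum
      fun n _ => (by have := hp n; fun_prop : Continuous _).intervalIntegrable _ _]
    exact hU N)
  linarith

/-! ### Non-stationary phase and Fourier windows -/

/-- Non-stationary phase, by one integration by parts. -/
theorem norm_oscillatory_integral_le {α β : ℝ} (hαβ : α ≤ β) {g g' ψ ψ₁ ψ₂ : ℝ → ℝ}
    (hg : ∀ t ∈ Set.Icc α β, HasDerivAt g (g' t) t)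
    (hψ : ∀ t ∈ Set.Icc α β, HasDerivAt ψ (ψ₁ t) t)
    (hψ₁ : ∀ t ∈ Set.Icc α β, HasDerivAt ψ₁ (ψ₂ t) t)
    (hg' : ContinuousOn g' (Set.Icc α β)) (hψ₂ : ContinuousOn ψ₂ (Set.Icc α β))
    (hα : g α = 0) (hβ : g β = 0) {A A' K L : ℝ} (hK : 0 < K)
    (hA : ∀ t ∈ Set.Icc α β, |g t| ≤ A) (hA' : ∀ t ∈ Set.Icc α β, |g' t| ≤ A')
    (hψK : ∀ t ∈ Set.Icc α β, K ≤ |ψ₁ t|) (hψL : ∀ t ∈ Set.Icc α β, |ψ₂ t| ≤ L * K) :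
    ‖∫ t in α..β, (g t : ℂ) * Complex.exp (ψ t * Complex.I)‖ ≤ (A' + L * A) * (β - α) / K := by
  have hne : ∀ t ∈ Set.Icc α β, ψ₁ t ≠ 0 := fun t ht h => by
    have := hψK t ht
    rw [h, abs_zero] at this
    linarith
  have huIcc : Set.uIcc α β = Set.Icc α β := Set.uIcc_of_le hαβ
  set q : ℝ → ℝ := fun t => (g' t * ψ₁ t - g t * ψ₂ t) / ψ₁ t ^ 2 with hq
  have hu : ∀ t ∈ Set.uIcc α β, HasDerivAt (fun t => ((g t / ψ₁ t : ℝ) : ℂ)) ((q t : ℝ) : ℂ) t := by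
    intro t ht
    rw [huIcc] at ht
    exact ((hg t ht).div (hψ₁ t ht) (hne t ht)).ofReal_comp
  have hv : ∀ t ∈ Set.uIcc α β, HasDerivAt (fun t => Complex.exp (ψ t * Complex.I))
      (Complex.exp (ψ t * Complex.I) * ((ψ₁ t : ℝ) * Complex.I)) t := by
    intro t ht
    rw [huIcc] at ht
    exact ((hψ t ht).ofReal_comp.mul_const Complex.I).cexp
  have hgc : ContinuousOn g (Set.Icc α β) := fun t ht => (hg t ht).continuousAt.continuousWithinAt
  have hψc : ContinuousOn ψ (Set.Icc α β) := fun t ht => (hψ t ht).continuousAt.continuousWithinAt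
  have hψ₁c : ContinuousOn ψ₁ (Set.Icc α β) :=
    fun t ht => (hψ₁ t ht).continuousAt.continuousWithinAt
  have hqc : ContinuousOn q (Set.Icc α β) :=
    ((hg'.mul hψ₁c).sub (hgc.mul hψ₂)).div (hψ₁c.pow 2) fun t ht => pow_ne_zero 2 (hne t ht)
  have hu' : IntervalIntegrable (fun t => ((q t : ℝ) : ℂ)) volume α β := by
    apply ContinuousOn.intervalIntegrable
    rw [huIcc]
    exact Complex.continuous_ofReal.comp_continuousOn hqc
  have hec : ContinuousOn (fun t => Complex.exp (ψ t * Complex.I)) (Set.Icc α β) :=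
    Complex.continuous_exp.comp_continuousOn
      ((Complex.continuous_ofReal.comp_continuousOn hψc).mul continuousOn_const)
  have hv' : IntervalIntegrable
      (fun t => Complex.exp (ψ t * Complex.I) * ((ψ₁ t : ℝ) * Complex.I)) volume α β := by
    apply ContinuousOn.intervalIntegrable
    rw [huIcc]
    exact hec.mul ((Complex.continuous_ofReal.comp_continuousOn hψ₁c).mul continuousOn_const)
  -- The derivative is moved from `exp(iψ)` onto `g/ψ'`; the boundary terms vanish with `g`. The
  -- resulting factor `(g'ψ' - gψ'')/ψ'²` is at most `(A' + LA)/K`.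
  have hibp := intervalIntegral.integral_mul_deriv_eq_deriv_mul hu hv hu' hv'
  have hlhs : ∫ t in α..β, ((g t / ψ₁ t : ℝ) : ℂ) *
      (Complex.exp (ψ t * Complex.I) * ((ψ₁ t : ℝ) * Complex.I)) =
      (∫ t in α..β, (g t : ℂ) * Complex.exp (ψ t * Complex.I)) * Complex.I := by
    rw [← intervalIntegral.integral_mul_const]
    apply intervalIntegral.integral_congr
    intro t ht
    rw [huIcc] at ht
    have : (ψ₁ t : ℂ) ≠ 0 := by exact_mod_cast hne t ht
    simp only
    push_cast
    field_simp
  rw [hlhs, hα, hβ] at hibp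
  have hnorm : ‖∫ t in α..β, (g t : ℂ) * Complex.exp (ψ t * Complex.I)‖ =
      ‖∫ t in α..β, ((q t : ℝ) : ℂ) * Complex.exp (ψ t * Complex.I)‖ := by
    have h := congrArg norm hibp
    simpa using h
  rw [hnorm]
  have hbound := intervalIntegral.norm_integral_le_of_norm_le_const
    (a := α) (b := β) (C := (A' + L * A) / K)
    (f := fun t => ((q t : ℝ) : ℂ) * Complex.exp (ψ t * Complex.I)) (by
      intro t ht
      rw [Set.uIoc_of_le hαβ] at ht
      have ht' : t ∈ Set.Icc α β := ⟨ht.1.le, ht.2⟩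
      have hψt := hψK t ht'
      have hpos : 0 < |ψ₁ t| := hK.trans_le hψt
      have hA0 : 0 ≤ A := (abs_nonneg _).trans (hA t ht')
      have hA'0 : 0 ≤ A' := (abs_nonneg _).trans (hA' t ht')
      have hLK : 0 ≤ L * K := (abs_nonneg _).trans (hψL t ht')
      have hL : 0 ≤ L := by
        by_contra h
        rw [not_le] at h
        nlinarith
      rw [norm_mul, Complex.norm_exp_ofReal_mul_I, mul_one, Complex.norm_real, Real.norm_eq_abs, hq,
        abs_div, abs_pow, div_le_div_iff₀ (by positivity) hK]
      have h1 : |g' t * ψ₁ t - g t * ψ₂ t| ≤ A' * |ψ₁ t| + A * (L * K) := by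
        refine (abs_sub _ _).trans ?_
        rw [abs_mul, abs_mul]
        exact add_le_add (mul_le_mul_of_nonneg_right (hA' t ht') (abs_nonneg _))
          (mul_le_mul (hA t ht') (hψL t ht') (abs_nonneg _) hA0)
      calc |g' t * ψ₁ t - g t * ψ₂ t| * K ≤ (A' * |ψ₁ t| + A * (L * K)) * K := by gcongr
        _ = A' * (|ψ₁ t| * K) + L * A * (K * K) := by ring
        _ ≤ A' * (|ψ₁ t| * |ψ₁ t|) + L * A * (|ψ₁ t| * |ψ₁ t|) := by gcongr
        _ = (A' + L * A) * |ψ₁ t| ^ 2 := by ring)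
  rw [abs_of_nonneg (sub_nonneg.2 hαβ)] at hbound
  calc _ ≤ _ := hbound
    _ = _ := by ring

open scoped FourierTransform in
-- The cosine is two exponentials, with phases `±θ - 2πst`; neither is stationary while `2πs` stays
-- at distance `K` from `±θ'`.
theorem norm_fourier_cos_le {α β : ℝ} (hαβ : α ≤ β) {g g' θ θ₁ θ₂ : ℝ → ℝ}
    (hg : ∀ t ∈ Set.Icc α β, HasDerivAt g (g' t) t)
    (hθ : ∀ t ∈ Set.Icc α β, HasDerivAt θ (θ₁ t) t)
    (hθ₁ : ∀ t ∈ Set.Icc α β, HasDerivAt θ₁ (θ₂ t) t)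
    (hg' : ContinuousOn g' (Set.Icc α β)) (hθ₂ : ContinuousOn θ₂ (Set.Icc α β))
    (hg0 : ∀ t ∉ Set.Ioo α β, g t = 0) {A A' K L s : ℝ} (hK : 0 < K)
    (hA : ∀ t ∈ Set.Icc α β, |g t| ≤ A) (hA' : ∀ t ∈ Set.Icc α β, |g' t| ≤ A')
    (hK₁ : ∀ t ∈ Set.Icc α β, K ≤ |θ₁ t - 2 * Real.pi * s|)
    (hK₂ : ∀ t ∈ Set.Icc α β, K ≤ |θ₁ t + 2 * Real.pi * s|)
    (hL : ∀ t ∈ Set.Icc α β, |θ₂ t| ≤ L * K) :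
    ‖𝓕 (fun t => ((g t * (2 * Real.cos (θ t)) : ℝ) : ℂ)) s‖ ≤
      2 * ((A' + L * A) * (β - α) / K) := by
  have hα : g α = 0 := hg0 α (by simp)
  have hβ : g β = 0 := hg0 β (by simp)
  have hd : ∀ t, HasDerivAt (fun t => 2 * Real.pi * s * t) (2 * Real.pi * s) t := fun t => by
    simpa using (hasDerivAt_id t).const_mul (2 * Real.pi * s)
  have h1 := norm_oscillatory_integral_le hαβ (ψ := fun t => θ t - 2 * Real.pi * s * t)
    (ψ₁ := fun t => θ₁ t - 2 * Real.pi * s) (ψ₂ := θ₂) hg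
    (fun t ht => (hθ t ht).sub (hd t))
    (fun t ht => (hθ₁ t ht).sub_const _) hg' hθ₂ hα hβ hK hA hA' hK₁ hL
  have h2 := norm_oscillatory_integral_le hαβ (ψ := fun t => -(θ t) - 2 * Real.pi * s * t)
    (ψ₁ := fun t => -(θ₁ t) - 2 * Real.pi * s) (ψ₂ := fun t => -(θ₂ t)) hg
    (fun t ht => (hθ t ht).neg.sub (hd t))
    (fun t ht => (hθ₁ t ht).neg.sub_const _) hg' hθ₂.neg hα hβ hK hA hA'
    (fun t ht => by
      rw [← abs_neg]
      convert hK₂ t ht using 2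
      ring)
    (fun t ht => by rw [abs_neg]; exact hL t ht)
  have hgc : ContinuousOn g (Set.Icc α β) := fun t ht => (hg t ht).continuousAt.continuousWithinAt
  have hθc : ContinuousOn θ (Set.Icc α β) := fun t ht => (hθ t ht).continuousAt.continuousWithinAt
  have hInt : ∀ ψ : ℝ → ℝ, ContinuousOn ψ (Set.Icc α β) →
      IntervalIntegrable (fun t => (g t : ℂ) * Complex.exp (ψ t * Complex.I)) volume α β := by
    intro ψ hψ
    apply ContinuousOn.intervalIntegrable
    rw [Set.uIcc_of_le hαβ]
    exact (Complex.continuous_ofReal.comp_continuousOn hgc).mul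
      (Complex.continuous_exp.comp_continuousOn
      ((Complex.continuous_ofReal.comp_continuousOn hψ).mul continuousOn_const))
  have heq : 𝓕 (fun t => ((g t * (2 * Real.cos (θ t)) : ℝ) : ℂ)) s =
      (∫ t in α..β, (g t : ℂ) * Complex.exp (((θ t - 2 * Real.pi * s * t : ℝ) : ℂ) * Complex.I)) +
      ∫ t in α..β, (g t : ℂ) *
        Complex.exp (((-(θ t) - 2 * Real.pi * s * t : ℝ) : ℂ) * Complex.I) := by
    rw [← intervalIntegral.integral_add
      (hInt (fun t => θ t - 2 * Real.pi * s * t) (hθc.sub (by fun_prop)))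
      (hInt (fun t => -(θ t) - 2 * Real.pi * s * t) (hθc.neg.sub (by fun_prop))), Real.fourier_real_eq_integral_exp_smul,
      intervalIntegral.integral_of_le hαβ,
      ← setIntegral_eq_integral_of_forall_compl_eq_zero (s := Set.Ioc α β)]
    · congr 1
      funext t
      have : ((2 * Real.cos (θ t) : ℝ) : ℂ) =
          Complex.exp (θ t * Complex.I) + Complex.exp (-(θ t * Complex.I)) := by
        push_cast
        rw [Complex.two_cos]
        simp
      rw [smul_eq_mul, Complex.ofReal_mul (g t), this, ← mul_add]
      rw [mul_left_comm, mul_add, ← Complex.exp_add, ← Complex.exp_add]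
      congr 3
      · push_cast; ring_nf
      · push_cast; ring_nf
    · intro t ht
      rw [hg0 t (fun h => ht ⟨h.1, h.2.le⟩)]
      simp
  rw [heq]
  refine (norm_add_le _ _).trans ?_
  linarith

theorem integral_Ioi_norm_sq_le {f : ℝ → ℝ} (hf : Integrable f) {C S : ℝ} (hS : 0 < S)
    (h : ∀ s, S < s → f s ≤ C ^ 2 / s ^ 2) : ∫ s in Set.Ioi S, f s ≤ C ^ 2 / S := by
  have hi := integrableOn_Ioi_rpow_of_lt (show (-2 : ℝ) < -1 by norm_num) hS
  calc ∫ s in Set.Ioi S, f s ≤ ∫ s in Set.Ioi S, C ^ 2 * s ^ (-2 : ℝ) := by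
        apply setIntegral_mono_on hf.integrableOn (hi.const_mul _) measurableSet_Ioi
        intro s hs
        have hs0 : 0 < s := hS.trans hs
        rw [Real.rpow_neg hs0.le, Real.rpow_two, ← div_eq_mul_inv]
        exact h s hs
    _ = C ^ 2 / S := by
        rw [integral_const_mul, integral_Ioi_rpow_of_lt (by norm_num) hS]
        norm_num
        rw [Real.rpow_neg_one, div_eq_mul_inv]

theorem integral_sub_le_window {f : ℝ → ℝ} (hf : Integrable f) {C S : ℝ} (hS : 0 < S)
    (h : ∀ s, S ≤ |s| → f s ≤ C ^ 2 / s ^ 2) :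
    (∫ s, f s) - 2 * C ^ 2 / S ≤ ∫ s in (-S)..S, f s := by
  have h1 := integral_Ioi_norm_sq_le hf hS fun s hs => h s (hs.le.trans (le_abs_self s))
  have h2 := integral_Ioi_norm_sq_le hf.comp_neg hS (C := C) fun s hs => by
    have := h (-s) (by rw [abs_neg]; exact hs.le.trans (le_abs_self s))
    rwa [neg_sq] at this
  rw [integral_comp_neg_Ioi] at h2
  have h3 := intervalIntegral.integral_Iic_add_Ioi (b := -S) hf.integrableOn hf.integrableOn
  have h4 := intervalIntegral.integral_interval_add_Ioi (a := -S) (b := S) hf.integrableOn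
    hf.integrableOn
  have h5 : 2 * C ^ 2 / S = C ^ 2 / S + C ^ 2 / S := by ring
  linarith

open scoped FourierTransform ContDiff in
theorem integrable_norm_sq_fourier {h : ℝ → ℂ} (hc : HasCompactSupport h) (hs : ContDiff ℝ ∞ h) :
    Integrable fun s => ‖𝓕 h s‖ ^ 2 := by
  have := (𝓕 (hc.toSchwartzMap hs)).memLp 2
  exact (memLp_two_iff_integrable_sq_norm this.1).1 this

open scoped FourierTransform ContDiff in
theorem continuous_fourier_of_hasCompactSupport {h : ℝ → ℂ} (hc : HasCompactSupport h)
    (hs : ContDiff ℝ ∞ h) : Continuous (𝓕 h) :=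
  (𝓕 (hc.toSchwartzMap hs)).continuous

open scoped FourierTransform ContDiff in
theorem integral_norm_sq_fourier_of_hasCompactSupport {h : ℝ → ℂ} (hc : HasCompactSupport h)
    (hs : ContDiff ℝ ∞ h) : ∫ s, ‖𝓕 h s‖ ^ 2 = ∫ t, ‖h t‖ ^ 2 :=
  SchwartzMap.integral_norm_sq_fourier (hc.toSchwartzMap hs)

open scoped ContDiff in
theorem contDiff_mul_of_tsupport_subset {g u : ℝ → ℝ} {Λ : Set ℝ} (hΛ : IsOpen Λ)
    (hg : ContDiff ℝ ∞ g) (hgs : tsupport g ⊆ Λ) (hu : ContDiffOn ℝ ∞ u Λ) :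
    ContDiff ℝ ∞ fun t => g t * u t := by
  rw [contDiff_iff_contDiffAt]
  intro t
  by_cases ht : t ∈ Λ
  · exact hg.contDiffAt.mul (hu.contDiffAt (hΛ.mem_nhds ht))
  · have h : (fun t => g t * u t) =ᶠ[𝓝 t] fun _ => 0 := by
      filter_upwards [notMem_tsupport_iff_eventuallyEq.1 fun h => ht (hgs h)] with s hs
      rw [hs, Pi.zero_apply, zero_mul]
    exact contDiffAt_const.congr_of_eventuallyEq h

open scoped FourierTransform ContDiff in
-- The frequencies `θ_n'` lie in `[m₂ x_n, M₂ x_n]`. A window reaching past `M x_n` misses only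
-- `O(1/S)` of the mass by decay in `s`; one ending before `m x_n` sees a transform of size
-- `O(1/x_n)`. The gaps `m < m₂` and `M₂ < M` make these bounds uniform.
theorem window_bounds {α β m m₂ M M₂ D : ℝ} (hαβ : α ≤ β) {g : ℝ → ℝ} {θ θ₁ θ₂ : ℕ → ℝ → ℝ}
    {x : ℕ → ℝ} (hg : ContDiff ℝ ∞ g) (hg0 : ∀ t ∉ Set.Ioo α β, g t = 0)
    (hθ : ∀ n, ∀ t ∈ Set.Icc α β, HasDerivAt (θ n) (θ₁ n t) t)
    (hθ₁ : ∀ n, ∀ t ∈ Set.Icc α β, HasDerivAt (θ₁ n) (θ₂ n t) t)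
    (hθ₂ : ∀ n, ContinuousOn (θ₂ n) (Set.Icc α β))
    (hh : ∀ n, ContDiff ℝ ∞ fun t => ((g t * (2 * Real.cos (θ n t)) : ℝ) : ℂ))
    (hm : 0 < m) (hm₂ : m < m₂) (hM₂ : M₂ < M) (hM₂0 : 0 < M₂) (hx : Tendsto x atTop atTop)
    (hP : ∀ᶠ n in atTop, ∀ t ∈ Set.Icc α β,
      m₂ * x n ≤ θ₁ n t ∧ θ₁ n t ≤ M₂ * x n ∧ |θ₂ n t| ≤ D * x n) :
    (∃ C, ∀ᶠ n in atTop, ∀ S > 0, M * x n ≤ 2 * Real.pi * S →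
      (∫ t, (g t * (2 * Real.cos (θ n t))) ^ 2) - C / S ≤
        ∫ s in (-S)..S, ‖𝓕 (fun t => ((g t * (2 * Real.cos (θ n t)) : ℝ) : ℂ)) s‖ ^ 2) ∧
    (∃ C, 0 ≤ C ∧ ∀ᶠ n in atTop, ∀ S > 0, 2 * Real.pi * S ≤ m * x n →
      ∫ s in (-S)..S, ‖𝓕 (fun t => ((g t * (2 * Real.cos (θ n t)) : ℝ) : ℂ)) s‖ ^ 2 ≤
        C * S / x n ^ 2) ∧
    Tendsto (fun n => ∫ t, (g t * (2 * Real.cos (θ n t))) ^ 2) atTop (𝓝 (2 * ∫ t, g t ^ 2)) := by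
  have hpi := Real.pi_pos
  have hgd : ∀ t, HasDerivAt g (deriv g t) t := fun t =>
    (hg.differentiable (by simp) t).hasDerivAt
  have hgc : Continuous g := hg.continuous
  have hgc' : Continuous (deriv g) := hg.continuous_deriv (by simp)
  have hcs : ∀ {V : Type} [Zero V] [TopologicalSpace V] (f : ℝ → V),
      (∀ t, g t = 0 → f t = 0) → HasCompactSupport f := by
    intro V _ _ f hf
    refine HasCompactSupport.intro (isCompact_Icc (a := α) (b := β)) fun t ht => hf t (hg0 t ?_)
    exact fun h => ht ⟨h.1.le, h.2.le⟩
  obtain ⟨A, hA⟩ := (isCompact_Icc (a := α) (b := β)).exists_bound_of_continuousOn hgc.continuousOn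
  obtain ⟨A', hA'⟩ := (isCompact_Icc (a := α) (b := β)).exists_bound_of_continuousOn
    hgc'.continuousOn
  set h : ℕ → ℝ → ℂ := fun n t => ((g t * (2 * Real.cos (θ n t)) : ℝ) : ℂ) with hdef
  have hsupp : ∀ n, HasCompactSupport (h n) := fun n => hcs _ fun t ht => by simp [hdef, ht]
  have hnorm : ∀ n, ∫ s, ‖𝓕 (h n) s‖ ^ 2 = ∫ t, (g t * (2 * Real.cos (θ n t))) ^ 2 := by
    intro n
    rw [integral_norm_sq_fourier_of_hasCompactSupport (hsupp n) (hh n)]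
    simp only [hdef, Complex.norm_real, Real.norm_eq_abs, sq_abs]
  have hInt : ∀ n, Integrable fun s => ‖𝓕 (h n) s‖ ^ 2 := fun n =>
    integrable_norm_sq_fourier (hsupp n) (hh n)
  refine ⟨?_, ?_, ?_⟩
  · set C₁ := 2 * ((A' + D / (M - M₂) * A) * (β - α) / (2 * Real.pi * (1 - M₂ / M))) with hC₁
    refine ⟨2 * C₁ ^ 2, ?_⟩
    filter_upwards [hP, hx.eventually_gt_atTop 0] with n hn hxn S hS hMS
    rw [← hnorm]
    apply integral_sub_le_window (hInt n) hS
    intro s hs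
    have hM : 0 < M := hM₂0.trans hM₂
    have hs0 : 0 < |s| := hS.trans_le hs
    have hfac : 0 < 1 - M₂ / M := by
      rw [sub_pos, div_lt_one hM]; exact hM₂
    have hMs : x n ≤ 2 * Real.pi * |s| / M := by
      rw [le_div_iff₀ hM]
      have : 2 * Real.pi * S ≤ 2 * Real.pi * |s| := by gcongr
      linarith
    have hle : ∀ t ∈ Set.Icc α β, |θ₁ n t| ≤ M₂ / M * (2 * Real.pi * |s|) := by
      intro t ht
      obtain ⟨h1, h2, -⟩ := hn t ht
      have h3 : 0 < θ₁ n t := (mul_pos (hm.trans hm₂) hxn).trans_le h1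
      rw [abs_of_pos h3]
      calc θ₁ n t ≤ M₂ * x n := h2
        _ ≤ M₂ * (2 * Real.pi * |s| / M) := by gcongr
        _ = _ := by ring
    have habs : |2 * Real.pi * s| = 2 * Real.pi * |s| := by
      rw [abs_mul, abs_of_pos (by positivity)]
    -- Outside the window `|θ_n'| ≤ (M₂/M) 2π|s|`, which gives `K`; `L` is chosen so that `LK = D ·
    -- 2π|s|/M ≥ D x_n`.
    have hb := norm_fourier_cos_le hαβ (g' := deriv g) (θ := θ n) (s := s) (A := A) (A' := A')
      (K := 2 * Real.pi * |s| * (1 - M₂ / M)) (L := D / (M - M₂))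
      (fun t _ => hgd t) (hθ n) (hθ₁ n) hgc'.continuousOn (hθ₂ n) hg0 (by positivity) hA hA'
      (fun t ht => by
        have h1 := abs_sub_abs_le_abs_sub (2 * Real.pi * s) (θ₁ n t)
        rw [abs_sub_comm, habs] at h1
        have := hle t ht
        linarith)
      (fun t ht => by
        have h1 := abs_sub_abs_le_abs_sub (2 * Real.pi * s) (-θ₁ n t)
        rw [abs_neg, habs, sub_neg_eq_add, add_comm (2 * Real.pi * s)] at h1
        have := hle t ht
        linarith)
      (fun t ht => by
        have h1 := (hn t ht).2.2
        have hD : 0 ≤ D := by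
          have := (abs_nonneg _).trans h1
          exact nonneg_of_mul_nonneg_left this hxn
        have h2 : D / (M - M₂) * (2 * Real.pi * |s| * (1 - M₂ / M)) =
            D * (2 * Real.pi * |s| / M) := by
          have : M - M₂ ≠ 0 := by linarith
          field_simp
        rw [h2]
        exact h1.trans (by gcongr))
    have h3 : ‖𝓕 (h n) s‖ ≤ C₁ / |s| := by
      refine hb.trans (le_of_eq ?_)
      rw [hC₁]
      field_simp
    calc ‖𝓕 (h n) s‖ ^ 2 ≤ (C₁ / |s|) ^ 2 := by gcongr
      _ = C₁ ^ 2 / s ^ 2 := by rw [div_pow, sq_abs]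
  · set C₂ := 2 * ((A' + D / (m₂ - m) * A) * (β - α) / (m₂ - m)) with hC₂
    refine ⟨2 * C₂ ^ 2, by positivity, ?_⟩
    filter_upwards [hP, hx.eventually_gt_atTop 0] with n hn hxn S hS hmS
    have hd : 0 < m₂ - m := sub_pos.2 hm₂
    have hb : ∀ s ∈ Set.Icc (-S) S, ‖𝓕 (h n) s‖ ^ 2 ≤ (C₂ / x n) ^ 2 := by
      intro s hs
      have hs' : |s| ≤ S := abs_le.2 hs
      have habs : |2 * Real.pi * s| ≤ m * x n := by
        rw [abs_mul, abs_of_pos (show 0 < 2 * Real.pi by positivity)]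
        calc 2 * Real.pi * |s| ≤ 2 * Real.pi * S := by gcongr
          _ ≤ _ := hmS
      obtain ⟨ha1, ha2⟩ := abs_le.1 habs
      have hb := norm_fourier_cos_le hαβ (g' := deriv g) (θ := θ n) (s := s) (A := A) (A' := A')
        (K := (m₂ - m) * x n) (L := D / (m₂ - m))
        (fun t _ => hgd t) (hθ n) (hθ₁ n) hgc'.continuousOn (hθ₂ n) hg0 (by positivity) hA hA'
        (fun t ht => le_trans (by linarith [(hn t ht).1]) (le_abs_self _))
        (fun t ht => le_trans (by linarith [(hn t ht).1]) (le_abs_self _))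
        (fun t ht => by
          have h2 : D / (m₂ - m) * ((m₂ - m) * x n) = D * x n := by field_simp
          rw [h2]
          exact (hn t ht).2.2)
      have h3 : ‖𝓕 (h n) s‖ ≤ C₂ / x n := by
        refine hb.trans (le_of_eq ?_)
        rw [hC₂]
        field_simp
      gcongr
    have hcont := continuous_fourier_of_hasCompactSupport (hsupp n) (hh n)
    calc ∫ s in (-S)..S, ‖𝓕 (h n) s‖ ^ 2 ≤ ∫ s in (-S)..S, (C₂ / x n) ^ 2 := by
          apply intervalIntegral.integral_mono_on (by linarith)
          · exact (by fun_prop : Continuous _).intervalIntegrable _ _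
          · exact continuous_const.intervalIntegrable _ _
          · exact hb
      _ = _ := by
        rw [intervalIntegral.integral_const, smul_eq_mul, div_pow]
        ring
  · set C₃ := 2 * ((2 * A * A' + D / m₂ * A ^ 2) * (β - α) / (2 * m₂)) with hC₃
    have hm₂0 : 0 < m₂ := hm.trans hm₂
    rw [← tendsto_sub_nhds_zero_iff]
    apply squeeze_zero_norm' (a := fun n => C₃ / x n)
    · filter_upwards [hP, hx.eventually_gt_atTop 0] with n hn hxn
      -- From `(2 cos θ)² = 2 + 2 cos 2θ`, the error in the total mass is the Fourier transform at
      -- `0` of `2g² cos 2θ_n`, which is `O(1/x_n)`.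
      have hb := norm_fourier_cos_le hαβ (g := fun t => g t ^ 2) (g' := fun t => 2 * g t * deriv g t)
        (θ := fun t => 2 * θ n t) (θ₁ := fun t => 2 * θ₁ n t) (θ₂ := fun t => 2 * θ₂ n t)
        (s := 0) (A := A ^ 2) (A' := 2 * A * A') (K := 2 * m₂ * x n) (L := D / m₂)
        (fun t _ => by
          have := (hgd t).fun_pow 2
          simpa using this)
        (fun t ht => (hθ n t ht).const_mul 2) (fun t ht => (hθ₁ n t ht).const_mul 2)
        (by fun_prop) (continuousOn_const.mul (hθ₂ n)) (fun t ht => by simp [hg0 t ht]) (by positivity)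
        (fun t ht => by
          rw [abs_pow]
          exact pow_le_pow_left₀ (abs_nonneg _) (hA t ht) 2)
        (fun t ht => by
          rw [abs_mul, abs_mul, abs_two]
          have h1 : |g t| ≤ A := hA t ht
          have h2 : |deriv g t| ≤ A' := hA' t ht
          have h3 := (abs_nonneg _).trans h1
          gcongr)
        (fun t ht => le_trans (by linarith [(hn t ht).1]) (le_abs_self _))
        (fun t ht => le_trans (by linarith [(hn t ht).1]) (le_abs_self _))
        (fun t ht => by
          have h2 : D / m₂ * (2 * m₂ * x n) = 2 * (D * x n) := by field_simp
          rw [h2, abs_mul, abs_two]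
          linarith [(hn t ht).2.2])
      have hcr : Continuous fun t => g t * (2 * Real.cos (θ n t)) := by
        have := Complex.continuous_re.comp (hh n).continuous
        exact this
      have heq : 𝓕 (fun t => ((g t ^ 2 * (2 * Real.cos (2 * θ n t)) : ℝ) : ℂ)) 0 =
          (((∫ t, (g t * (2 * Real.cos (θ n t))) ^ 2) - 2 * ∫ t, g t ^ 2 : ℝ) : ℂ) := by
        rw [Real.fourier_real_eq_integral_exp_smul]
        have h1 : (fun t => Complex.exp (((-2 * Real.pi * t * 0 : ℝ) : ℂ) * Complex.I) •
            ((g t ^ 2 * (2 * Real.cos (2 * θ n t)) : ℝ) : ℂ)) =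
            fun t => (((g t * (2 * Real.cos (θ n t))) ^ 2 - 2 * g t ^ 2 : ℝ) : ℂ) := by
          funext t
          rw [Real.cos_two_mul]
          simp
          ring
        rw [h1, integral_complex_ofReal, integral_sub, integral_const_mul]
        · exact (hcr.pow 2).integrable_of_hasCompactSupport (hcs _ fun t ht => by simp [ht])
        · exact ((hgc.pow 2).const_mul 2).integrable_of_hasCompactSupport
            (hcs _ fun t ht => by simp [ht])
      rw [heq, Complex.norm_real] at hb
      refine hb.trans (le_of_eq ?_)
      rw [hC₃]
      field_simp
    · exact tendsto_const_nhds.div_atTop hx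

open scoped FourierTransform in
theorem fourier_const_mul_add {f h : ℝ → ℂ} (hf : Integrable f) (hh : Integrable h) (c : ℂ)
    (s : ℝ) : 𝓕 (fun t => c * f t + h t) s = c * 𝓕 f s + 𝓕 h s := by
  have h1 := VectorFourier.fourierIntegral_add (μ := volume) (L := innerₗ ℝ)
    Real.continuous_fourierChar continuous_inner (hf.smul c) hh
  rw [VectorFourier.fourierIntegral_const_smul] at h1
  exact congrFun h1 s

/-! ### Inequalities tested on a bump function -/

namespace HasOscillatingAsymptotics

variable {a b : ℕ → ℝ} {Λ : Set ℝ} {κ ω : ℝ → ℝ} {x v : ℕ → ℝ} {Φ : ℕ → ℝ → ℝ}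

theorem hasDerivAt_of_contDiffOn {f : ℝ → ℝ} (hΛ : IsOpen Λ) (hf : ContDiffOn ℝ (⊤ : ℕ∞) f Λ)
    {t : ℝ} (ht : t ∈ Λ) : HasDerivAt f (deriv f t) t :=
  ((hf.contDiffAt (hΛ.mem_nhds ht)).differentiableAt (by simp)).hasDerivAt

theorem contDiffOn_deriv {f : ℝ → ℝ} (hΛ : IsOpen Λ) (hf : ContDiffOn ℝ (⊤ : ℕ∞) f Λ) :
    ContDiffOn ℝ (⊤ : ℕ∞) (deriv f) Λ :=
  hf.deriv_of_isOpen hΛ (by simp)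

/-- `Φ_n'` is `o(x_n)` and is absorbed by `η`; for the second derivative a bound `O(x_n)` is enough,
so `δ = 1` is used. -/
theorem phase_bounds (h : HasOscillatingAsymptotics a b Λ κ ω x v Φ) (hΛ : IsOpen Λ)
    {α β m₁ M₁ η : ℝ} (hsub : Set.Icc α β ⊆ Λ) (hη : 0 < η)
    (hω : ∀ t ∈ Set.Icc α β, m₁ ≤ deriv ω t ∧ deriv ω t ≤ M₁) :
    ∃ D, ∀ᶠ n in atTop, ∀ t ∈ Set.Icc α β,
      (m₁ - η) * x n ≤ deriv ω t * x n + deriv (Φ n) t ∧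
      deriv ω t * x n + deriv (Φ n) t ≤ (M₁ + η) * x n ∧
      |deriv (deriv ω) t * x n + deriv (deriv (Φ n)) t| ≤ D * x n := by
  obtain ⟨D, hD⟩ := (isCompact_Icc (a := α) (b := β)).exists_bound_of_continuousOn
    ((contDiffOn_deriv hΛ (contDiffOn_deriv hΛ h.ω_smooth)).continuousOn.mono hsub)
  refine ⟨D + 1, ?_⟩
  filter_upwards [h.Φ_deriv_isLittleO 1 (Or.inl rfl) α β hsub η hη,
    h.Φ_deriv_isLittleO 2 (Or.inr rfl) α β hsub 1 one_pos, h.x_tendsto.eventually_gt_atTop 0]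
    with n h1 h2 hx t ht
  have h1' := h1 t ht
  have h2' := h2 t ht
  rw [iteratedDeriv_one] at h1'
  rw [iteratedDeriv_succ, iteratedDeriv_one] at h2'
  obtain ⟨h3, h4⟩ := abs_le.1 h1'
  obtain ⟨h5, h6⟩ := hω t ht
  have h7 : m₁ * x n ≤ deriv ω t * x n := by gcongr
  have h8 : deriv ω t * x n ≤ M₁ * x n := by gcongr
  refine ⟨by linarith, by linarith, ?_⟩
  refine (abs_add_le _ _).trans ?_
  rw [abs_mul, abs_of_pos hx]
  have h9 : |deriv (deriv ω) t| ≤ D := hD t ht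
  have h10 : |deriv (deriv ω) t| * x n ≤ D * x n := by gcongr
  linarith

theorem contDiffOn_remainder (h : HasOscillatingAsymptotics a b Λ κ ω x v Φ) (n : ℕ) :
    ContDiffOn ℝ (⊤ : ℕ∞) (asymRemainder a b κ ω x v Φ n) Λ := by
  have h1 := h.ω_smooth
  have h2 := h.κ_smooth
  have h3 := h.Φ_smooth n
  refine ContDiffOn.sub (Polynomial.contDiff_aeval _ _).contDiffOn ?_
  exact ((contDiffOn_const.mul h2).mul contDiffOn_const).mul
    (Real.contDiff_cos.comp_contDiffOn ((h1.mul contDiffOn_const).add h3))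

open scoped FourierTransform in
theorem bump_inequalities (h : HasOscillatingAsymptotics a b Λ κ ω x v Φ)
    (hΛ : IsOpen Λ) {τ : ℝ → ℝ} (hτs : ContDiffOn ℝ (⊤ : ℕ∞) τ Λ) (hτpos : ∀ l ∈ Λ, 0 < τ l)
    (hparseval : ∀ (F : ℝ → ℂ) (C : ℝ), Continuous F → (∀ t, ‖F t‖ ≤ C) → (∀ t ∉ Λ, F t = 0) →
      HasSum (fun n => ‖∫ t, (τ t : ℂ) * (F t * polyFun a b n t)‖ ^ 2) (∫ t, τ t * ‖F t‖ ^ 2))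
    {α β m m₁ M₁ M : ℝ} (hαβ : α ≤ β) (hsub : Set.Icc α β ⊆ Λ) {g : ℝ → ℝ} (hg : ContDiff ℝ (⊤ : ℕ∞) g)
    (hg0 : ∀ t ∉ Set.Ioo α β, g t = 0) (hG : 0 < ∫ t, g t ^ 2)
    (hm : 0 < m) (hm₁ : m < m₁) (hM₁ : M₁ < M)
    (hω : ∀ t ∈ Set.Icc α β, m₁ ≤ deriv ω t ∧ deriv ω t ≤ M₁) {s : ℝ} (hs : 0 < s) :
    ((∀ᶠ n in atTop, s * (x (n + 1) - x n) ≤ v n ^ 2) →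
      2 * Real.pi * s * (∫ t, g t ^ 2) ≤ M * ∫ t, g t ^ 2 / (κ t ^ 2 * τ t)) ∧
    ((∀ᶠ n in atTop, v n ^ 2 ≤ s * (x (n + 1) - x n)) →
      Tendsto (fun n => (x (n + 1) - x n) / x n) atTop (𝓝 0) →
      m * (∫ t, g t ^ 2 / (κ t ^ 2 * τ t)) ≤ 2 * Real.pi * s * ∫ t, g t ^ 2) := by
  have hpi := Real.pi_pos
  have hts : tsupport g ⊆ Λ := by
    refine (closure_minimal ?_ isClosed_Icc).trans hsub
    intro t ht
    by_contra hc
    exact ht (hg0 t fun h => hc ⟨h.1.le, h.2.le⟩)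
  have hκne : ∀ t ∈ Λ, κ t ≠ 0 := fun t ht => (h.κ_pos t ht).ne'
  have hτne : ∀ t ∈ Λ, τ t ≠ 0 := fun t ht => (hτpos t ht).ne'
  have hgΛ : ∀ t ∉ Λ, g t = 0 := fun t ht => hg0 t fun h => ht (hsub ⟨h.1.le, h.2.le⟩)
  have hcs : ∀ {V : Type} [Zero V] [TopologicalSpace V] (f : ℝ → V),
      (∀ t, g t = 0 → f t = 0) → HasCompactSupport f := by
    intro V _ _ f hf
    refine HasCompactSupport.intro (isCompact_Icc (a := α) (b := β)) fun t ht => hf t (hg0 t ?_)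
    exact fun h => ht ⟨h.1.le, h.2.le⟩
  have hof : ∀ {f : ℝ → ℝ}, ContDiff ℝ (⊤ : ℕ∞) f → ContDiff ℝ (⊤ : ℕ∞) fun t => ((f t : ℝ) : ℂ) :=
    fun hf => Complex.ofRealCLM.contDiff.comp hf
  have hκinv : ContDiffOn ℝ (⊤ : ℕ∞) (fun t => (κ t)⁻¹) Λ := h.κ_smooth.inv hκne
  set θ : ℕ → ℝ → ℝ := fun n t => ω t * x n + Φ n t with hθdef
  set hf : ℕ → ℝ → ℂ := fun n t => ((g t * (2 * Real.cos (θ n t)) : ℝ) : ℂ) with hfdef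
  set rf : ℕ → ℝ → ℂ := fun n t =>
    ((g t * (asymRemainder a b κ ω x v Φ n t * (κ t)⁻¹) : ℝ) : ℂ) with rfdef
  set pf : ℕ → ℝ → ℂ := fun n t =>
    ((g t * ((jacobiPoly a b n).eval t * (κ t)⁻¹) : ℝ) : ℂ) with pfdef
  have hfs : ∀ n, ContDiff ℝ (⊤ : ℕ∞) (hf n) := fun n => hof (contDiff_mul_of_tsupport_subset hΛ hg hts
    (contDiffOn_const.mul (Real.contDiff_cos.comp_contDiffOn
      ((h.ω_smooth.mul contDiffOn_const).add (h.Φ_smooth n)))))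
  have rfs : ∀ n, ContDiff ℝ (⊤ : ℕ∞) (rf n) := fun n => hof (contDiff_mul_of_tsupport_subset hΛ hg hts
    ((h.contDiffOn_remainder n).mul hκinv))
  have pfs : ∀ n, ContDiff ℝ (⊤ : ℕ∞) (pf n) := fun n => hof (contDiff_mul_of_tsupport_subset hΛ hg hts
    ((Polynomial.contDiff_aeval _ _).contDiffOn.mul hκinv))
  have hfc : ∀ n, HasCompactSupport (hf n) := fun n => hcs _ fun t ht => by simp [hfdef, ht]
  have rfc : ∀ n, HasCompactSupport (rf n) := fun n => hcs _ fun t ht => by simp [rfdef, ht]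
  have pfc : ∀ n, HasCompactSupport (pf n) := fun n => hcs _ fun t ht => by simp [pfdef, ht]
  have hdecomp : ∀ n t, 𝓕 (pf n) t = (v n : ℂ) * 𝓕 (hf n) t + 𝓕 (rf n) t := by
    intro n t
    rw [← fourier_const_mul_add ((hfs n).continuous.integrable_of_hasCompactSupport (hfc n))
      ((rfs n).continuous.integrable_of_hasCompactSupport (rfc n))]
    refine congrFun (congrArg 𝓕 (funext fun u => ?_)) t
    by_cases hu : u ∈ Λ
    · have := hκne u hu
      simp only [pfdef, hfdef, rfdef, asymRemainder, hθdef]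
      norm_cast
      field_simp
      ring
    · simp [pfdef, hfdef, rfdef, hgΛ u hu]
  set Q := ∫ t, g t ^ 2 / (κ t ^ 2 * τ t) with hQ
  have hpars : ∀ u, HasSum (fun n => ‖𝓕 (pf n) u‖ ^ 2) Q := by
    intro u
    have hFs : ContDiff ℝ (⊤ : ℕ∞) fun t => g t * ((κ t)⁻¹ * (τ t)⁻¹) :=
      contDiff_mul_of_tsupport_subset hΛ hg hts (hκinv.mul (hτs.inv hτne))
    have hFc : HasCompactSupport fun t => g t * ((κ t)⁻¹ * (τ t)⁻¹) :=
      hcs _ fun t ht => by simp [ht]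
    obtain ⟨C, hC⟩ := hFc.exists_bound_of_continuous hFs.continuous
    have hFcont := hFs.continuous
    -- With this `F` the density `τ` cancels and the coefficients become `𝓕(g P_n / κ)(u)`; the
    -- character has modulus one, so the total is `Q` for every `u`.
    have hp := hparseval (fun t => Complex.exp (((-2 * Real.pi * t * u : ℝ) : ℂ) * Complex.I) *
      ((g t * ((κ t)⁻¹ * (τ t)⁻¹) : ℝ) : ℂ)) C (by fun_prop)
      (fun t => by
        rw [norm_mul, Complex.norm_exp_ofReal_mul_I, one_mul, Complex.norm_real]; exact hC t)
      (fun t ht => by simp [hgΛ t ht])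
    convert hp using 1
    · funext n
      rw [Real.fourier_real_eq_integral_exp_smul]
      congr 3
      funext t
      by_cases ht : t ∈ Λ
      · have h1 := hκne t ht
        have h2 : (τ t : ℂ) ≠ 0 := by exact_mod_cast hτne t ht
        simp only [pfdef, polyFun, smul_eq_mul]
        push_cast
        field_simp
      · simp [pfdef, hgΛ t ht]
    · rw [hQ]
      congr 1
      funext t
      rw [norm_mul, Complex.norm_exp_ofReal_mul_I, one_mul, Complex.norm_real, Real.norm_eq_abs,
        sq_abs]
      by_cases ht : t ∈ Λ
      · have h1 := hκne t ht
        have h2 := hτne t ht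
        field_simp
      · simp [hgΛ t ht]
  obtain ⟨Cr, hCr⟩ := h.remainder α β hsub
  have hrcs : ContDiff ℝ (⊤ : ℕ∞) fun t => g t * (κ t)⁻¹ :=
    contDiff_mul_of_tsupport_subset hΛ hg hts hκinv
  have hrsq : ∀ n, Integrable fun t => ‖rf n t‖ ^ 2 := fun n =>
    ((rfs n).continuous.norm.pow 2).integrable_of_hasCompactSupport
      (hcs _ fun t ht => by simp [rfdef, ht])
  -- Plancherel returns the sum to the variable `t`, where the uniform bound on `∑ ε_n(t)²` applies
  -- pointwise on the support of `g`.
  have hrC : ∀ F : Finset ℕ, ∑ n ∈ F, ∫ u, ‖𝓕 (rf n) u‖ ^ 2 ≤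
      ∫ t, Cr * (g t * (κ t)⁻¹) ^ 2 := by
    intro F
    have h1 : ∀ n, ∫ u, ‖𝓕 (rf n) u‖ ^ 2 = ∫ t, ‖rf n t‖ ^ 2 := fun n =>
      integral_norm_sq_fourier_of_hasCompactSupport (rfc n) (rfs n)
    simp only [h1]
    rw [← integral_finsetSum _ fun n _ => hrsq n]
    apply integral_mono (integrable_finsetSum _ fun n _ => hrsq n)
      (((hrcs.continuous.pow 2).const_mul Cr).integrable_of_hasCompactSupport
        (hcs _ fun t ht => by simp [ht]))
    intro t
    by_cases ht : t ∈ Set.Icc α β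
    · obtain ⟨h2, h3⟩ := hCr t ht
      have h4 := (h2.sum_le_tsum F fun _ _ => sq_nonneg _).trans h3
      have h5 : ∑ n ∈ F, ‖rf n t‖ ^ 2 =
          (∑ n ∈ F, asymRemainder a b κ ω x v Φ n t ^ 2) * (g t * (κ t)⁻¹) ^ 2 := by
        rw [Finset.sum_mul]
        refine Finset.sum_congr rfl fun n _ => ?_
        rw [rfdef]
        simp only [Complex.norm_real, Real.norm_eq_abs, sq_abs]
        ring
      simp only [h5]
      exact mul_le_mul_of_nonneg_right h4 (sq_nonneg _)
    · have h2 : g t = 0 := hg0 t fun h => ht ⟨h.1.le, h.2.le⟩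
      simp [rfdef, h2]
  set C' := ∫ t, Cr * (g t * (κ t)⁻¹) ^ 2 with hC'
  have hpcont : ∀ n, Continuous (𝓕 (pf n)) := fun n =>
    continuous_fourier_of_hasCompactSupport (pfc n) (pfs n)
  have hhcont : ∀ n, Continuous (𝓕 (hf n)) := fun n =>
    continuous_fourier_of_hasCompactSupport (hfc n) (hfs n)
  have hrcont : ∀ n, Continuous (𝓕 (rf n)) := fun n =>
    continuous_fourier_of_hasCompactSupport (rfc n) (rfs n)
  have hrint : ∀ n, Integrable fun u => ‖𝓕 (rf n) u‖ ^ 2 := fun n =>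
    integrable_norm_sq_fourier (rfc n) (rfs n)
  have hvW : ∀ n S, v n ^ 2 * ∫ u in (-S)..S, ‖𝓕 (hf n) u‖ ^ 2 =
      ∫ u in (-S)..S, ‖(v n : ℂ) * 𝓕 (hf n) u‖ ^ 2 := by
    intro n S
    rw [← intervalIntegral.integral_const_mul]
    congr 1
    funext u
    rw [norm_mul, mul_pow, Complex.norm_real, Real.norm_eq_abs, sq_abs]
  have hsumA : ∀ δ > 0, ∃ D, ∀ S > 0, ∀ F : Finset ℕ,
      ∑ n ∈ F, v n ^ 2 * (∫ u in (-S)..S, ‖𝓕 (hf n) u‖ ^ 2) ≤ (1 + δ) * (2 * S * Q) + D := by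
    intro δ hδ
    refine ⟨(1 + δ⁻¹) * C', fun S hS F => ?_⟩
    -- The oscillating part is the polynomial part minus the remainder; the reverse estimate `hsumB`
    -- treats the remainder as the perturbation of the oscillating part.
    have h1 := sum_window_norm_sq_le (p := fun n => 𝓕 (pf n)) (r := fun n u => -𝓕 (rf n) u)
      hpcont (fun n => (hrcont n).neg) (C' := C') (fun n => by simpa using hrint n)
      (fun F => by simpa using hrC F) hδ hS F
    have h2 := sum_window_le_of_hasSum hpcont hpars hS F
    have h3 : ∀ n u, 𝓕 (pf n) u + -𝓕 (rf n) u = (v n : ℂ) * 𝓕 (hf n) u := fun n u => by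
      rw [hdecomp]; ring
    simp only [h3, ← hvW] at h1
    refine h1.trans ?_
    gcongr
  have hsumB : ∀ δ > 0, ∃ D, ∀ S > 0, ∀ U,
      (∀ N, ∑ n ∈ Finset.range N, v n ^ 2 * (∫ u in (-S)..S, ‖𝓕 (hf n) u‖ ^ 2) ≤ U) →
      2 * S * Q ≤ (1 + δ) * U + D := by
    intro δ hδ
    refine ⟨(1 + δ⁻¹) * C', fun S hS U hU => ?_⟩
    refine le_of_forall_sum_window_le hpcont hpars fun N => ?_
    have h1 := sum_window_norm_sq_le (p := fun n u => (v n : ℂ) * 𝓕 (hf n) u)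
      (r := fun n => 𝓕 (rf n)) (fun n => (hhcont n).const_mul _) hrcont hrint hrC hδ hS
      (Finset.range N)
    simp only [← hdecomp, ← hvW] at h1
    refine h1.trans ?_
    have := hU N
    gcongr
  have hη : 0 < min (m₁ - m) (M - M₁) / 2 := by
    have := lt_min (sub_pos.2 hm₁) (sub_pos.2 hM₁)
    positivity
  have hη1 := min_le_left (m₁ - m) (M - M₁)
  have hη2 := min_le_right (m₁ - m) (M - M₁)
  set η := min (m₁ - m) (M - M₁) / 2 with hηdef
  obtain ⟨D, hD⟩ := h.phase_bounds hΛ hsub hη hω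
  have hM₁0 : 0 < M₁ := by
    obtain ⟨h1, h2⟩ := hω α (Set.left_mem_Icc.2 hαβ)
    linarith
  obtain ⟨⟨C₁, hW₁⟩, ⟨C₂, hC₂, hW₂⟩, hW₃⟩ := window_bounds (m := m) (m₂ := m₁ - η) (M := M)
    (M₂ := M₁ + η) (D := D) hαβ (θ := θ) (θ₁ := fun n t => deriv ω t * x n + deriv (Φ n) t)
    (θ₂ := fun n t => deriv (deriv ω) t * x n + deriv (deriv (Φ n)) t) (x := x) hg hg0
    (fun n t ht => ((hasDerivAt_of_contDiffOn hΛ h.ω_smooth (hsub ht)).mul_const _).add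
      (hasDerivAt_of_contDiffOn hΛ (h.Φ_smooth n) (hsub ht)))
    (fun n t ht => ((hasDerivAt_of_contDiffOn hΛ
      (contDiffOn_deriv hΛ h.ω_smooth) (hsub ht)).mul_const _).add
      (hasDerivAt_of_contDiffOn hΛ (contDiffOn_deriv hΛ (h.Φ_smooth n)) (hsub ht)))
    (fun n => (((contDiffOn_deriv hΛ (contDiffOn_deriv hΛ h.ω_smooth)).continuousOn.mono hsub).mul
      continuousOn_const).add
      ((contDiffOn_deriv hΛ (contDiffOn_deriv hΛ (h.Φ_smooth n))).continuousOn.mono hsub))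
    hfs hm (by linarith) (by linarith) (by linarith) h.x_tendsto hD
  refine ⟨fun hv => ?_, fun hv hratio => ?_⟩
  · exact le_of_summed_window_lower_bound hG (by linarith) hs h.x_tendsto hW₃ hW₁ hsumA hv h.x_lt
  · refine le_of_summed_window_upper_bound hG hm hs hC₂ h.x_tendsto hW₃ ?_ ?_ hW₂ hsumB hv h.x_lt
      hratio
    · intro n S hS
      exact intervalIntegral.integral_nonneg (by linarith) fun _ _ => by positivity
    · intro n S hS
      have h1 : ∫ u, ‖𝓕 (hf n) u‖ ^ 2 = ∫ t, (g t * (2 * Real.cos (θ n t))) ^ 2 := by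
        rw [integral_norm_sq_fourier_of_hasCompactSupport (hfc n) (hfs n)]
        simp only [hfdef, Complex.norm_real, Real.norm_eq_abs, sq_abs]
      rw [← h1, intervalIntegral.integral_of_le (by linarith)]
      exact setIntegral_le_integral (integrable_norm_sq_fourier (hfc n) (hfs n))
        (ae_of_all _ fun s => by positivity)

end HasOscillatingAsymptotics

/-! ### Localization at a point and the limit `σ` -/

namespace HasOscillatingAsymptotics

variable {a b : ℕ → ℝ} {Λ : Set ℝ} {κ ω : ℝ → ℝ} {x v : ℕ → ℝ} {Φ : ℕ → ℝ → ℝ}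

theorem exists_bump {l : ℝ} {U : Set ℝ} (hU : U ∈ 𝓝 l) :
    ∃ (α β : ℝ) (g : ℝ → ℝ), α ≤ β ∧ Set.Icc α β ⊆ U ∧ ContDiff ℝ (⊤ : ℕ∞) g ∧
      (∀ t ∉ Set.Ioo α β, g t = 0) ∧ 0 < ∫ t, g t ^ 2 := by
  obtain ⟨r, hr, hrU⟩ := Metric.nhds_basis_closedBall.mem_iff.1 hU
  let g : ContDiffBump l := ⟨r / 2, r, by linarith, by linarith⟩
  refine ⟨l - r, l + r, g, by linarith, by rwa [← Real.closedBall_eq_Icc], g.contDiff, ?_, ?_⟩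
  · intro t ht
    rw [← Real.ball_eq_Ioo, Metric.mem_ball, not_lt] at ht
    exact g.zero_of_le_dist ht
  · refine Continuous.integral_pos_of_hasCompactSupport_nonneg_nonzero (g.continuous.pow 2)
      ?_ (fun t => sq_nonneg _) (x := l) ?_
    · refine g.hasCompactSupport.mono fun t ht => ?_
      rw [Function.mem_support] at ht ⊢
      exact fun h => ht (by simp [h])
    · have : g l = 1 := g.one_of_mem_closedBall (Metric.mem_closedBall_self (by positivity))
      simp [this]

/-- If an inequality failed at `l`, continuity would make `ω'` and `2πs κ²τ` nearly constant and
separated on a small interval; a bump supported there contradicts the integrated inequality. -/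
theorem density_bounds (h : HasOscillatingAsymptotics a b Λ κ ω x v Φ)
    (hΛ : IsOpen Λ) {τ : ℝ → ℝ} (hτs : ContDiffOn ℝ (⊤ : ℕ∞) τ Λ) (hτpos : ∀ l ∈ Λ, 0 < τ l)
    (hparseval : ∀ (F : ℝ → ℂ) (C : ℝ), Continuous F → (∀ t, ‖F t‖ ≤ C) → (∀ t ∉ Λ, F t = 0) →
      HasSum (fun n => ‖∫ t, (τ t : ℂ) * (F t * polyFun a b n t)‖ ^ 2) (∫ t, τ t * ‖F t‖ ^ 2))
    {l : ℝ} (hl : l ∈ Λ) {s : ℝ} (hs : 0 < s) :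
    ((∀ᶠ n in atTop, s * (x (n + 1) - x n) ≤ v n ^ 2) →
      2 * Real.pi * s * (κ l ^ 2 * τ l) ≤ deriv ω l) ∧
    ((∀ᶠ n in atTop, v n ^ 2 ≤ s * (x (n + 1) - x n)) →
      Tendsto (fun n => (x (n + 1) - x n) / x n) atTop (𝓝 0) →
      deriv ω l ≤ 2 * Real.pi * s * (κ l ^ 2 * τ l)) := by
  have hω0 := h.ω_deriv_pos l hl
  have hcω : ContinuousAt (deriv ω) l :=
    (contDiffOn_deriv hΛ h.ω_smooth).continuousOn.continuousAt (hΛ.mem_nhds hl)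
  have hcD : ContinuousOn (fun t => κ t ^ 2 * τ t) Λ :=
    (h.κ_smooth.continuousOn.pow 2).mul hτs.continuousOn
  have hcDl := hcD.continuousAt (hΛ.mem_nhds hl)
  have hDpos : ∀ t ∈ Λ, 0 < κ t ^ 2 * τ t := fun t ht => by
    have := h.κ_pos t ht
    have := hτpos t ht
    positivity
  have hQint : ∀ {α β : ℝ} {g : ℝ → ℝ}, Set.Icc α β ⊆ Λ → Continuous g →
      (∀ t ∉ Set.Ioo α β, g t = 0) → Integrable fun t => g t ^ 2 / (κ t ^ 2 * τ t) := by
    intro α β g hsub hg hg0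
    have h1 : ContinuousOn (fun t => g t ^ 2 / (κ t ^ 2 * τ t)) (Set.Icc α β) :=
      (hg.continuousOn.pow 2).div (hcD.mono hsub) fun t ht => (hDpos t (hsub ht)).ne'
    refine (integrableOn_iff_integrable_of_support_subset ?_).1 (h1.integrableOn_compact
      isCompact_Icc)
    intro t ht
    by_contra hc
    refine ht ?_
    simp [hg0 t fun h => hc ⟨h.1.le, h.2.le⟩]
  have hGint : ∀ {α β : ℝ} {g : ℝ → ℝ}, Continuous g →
      (∀ t ∉ Set.Ioo α β, g t = 0) → Integrable fun t => g t ^ 2 := by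
    intro α β g hg hg0
    refine (hg.pow 2).integrable_of_hasCompactSupport
      (HasCompactSupport.intro (isCompact_Icc (a := α) (b := β)) fun t ht => ?_)
    simp [hg0 t fun h => ht ⟨h.1.le, h.2.le⟩]
  constructor
  · intro hv
    by_contra hcon
    rw [not_le] at hcon
    set R := 2 * Real.pi * s * (κ l ^ 2 * τ l) with hR
    set ε := (R - deriv ω l) / 4 with hε
    have hε0 : 0 < ε := by rw [hε]; linarith
    have hU : ∀ᶠ t in 𝓝 l, t ∈ Λ ∧ (deriv ω l / 2 < deriv ω t ∧ deriv ω t < deriv ω l + ε) ∧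
        R - ε < 2 * Real.pi * s * (κ t ^ 2 * τ t) :=
      (hΛ.eventually_mem hl).and (((hcω.eventually (lt_mem_nhds (by linarith))).and
        (hcω.eventually (gt_mem_nhds (by linarith)))).and
        ((Tendsto.const_mul (2 * Real.pi * s) hcDl).eventually (lt_mem_nhds (by linarith))))
    obtain ⟨α, β, g, hαβ, hsub, hg, hg0, hG⟩ := exists_bump hU
    -- Only `M` enters this half; `m` and `m₁` need just be ordered positive lower bounds. The total
    -- loss `3ε` is less than the gap `R - ω'(l) = 4ε`.
    have hkey := (h.bump_inequalities hΛ hτs hτpos hparseval hαβ (fun t ht => (hsub ht).1) hg hg0 hG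
      (m := deriv ω l / 4) (m₁ := deriv ω l / 2) (M₁ := deriv ω l + ε) (M := deriv ω l + 2 * ε)
      (by linarith) (by linarith) (by linarith)
      (fun t ht => ⟨(hsub ht).2.1.1.le, (hsub ht).2.1.2.le⟩) hs).1 hv
    have hle : (R - ε) * ∫ t, g t ^ 2 / (κ t ^ 2 * τ t) ≤ 2 * Real.pi * s * ∫ t, g t ^ 2 := by
      rw [← integral_const_mul, ← integral_const_mul]
      apply integral_mono ((hQint (fun t ht => (hsub ht).1) hg.continuous hg0).const_mul _)
        ((hGint hg.continuous hg0).const_mul _)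
      intro t
      by_cases ht : t ∈ Set.Icc α β
      · obtain ⟨h1, -, h2⟩ := hsub ht
        have h3 := hDpos t h1
        simp only
        rw [mul_div_assoc', div_le_iff₀ h3]
        calc (R - ε) * g t ^ 2 ≤ (2 * Real.pi * s * (κ t ^ 2 * τ t)) * g t ^ 2 := by gcongr
          _ = _ := by ring
      · simp [hg0 t fun h => ht ⟨h.1.le, h.2.le⟩]
    have hlt : deriv ω l + 2 * ε < R - ε := by rw [hε]; linarith
    have hGp : 0 < 2 * Real.pi * s * ∫ t, g t ^ 2 := by
      have := Real.pi_pos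
      positivity
    nlinarith
  · intro hv hratio
    by_contra hcon
    rw [not_le] at hcon
    set R := 2 * Real.pi * s * (κ l ^ 2 * τ l) with hR
    have hR0 : 0 < R := by
      have := Real.pi_pos
      have := hDpos l hl
      positivity
    set ε := (deriv ω l - R) / 4 with hε
    have hε0 : 0 < ε := by rw [hε]; linarith
    have hU : ∀ᶠ t in 𝓝 l, t ∈ Λ ∧ (deriv ω l - ε < deriv ω t ∧ deriv ω t < deriv ω l + ε) ∧
        2 * Real.pi * s * (κ t ^ 2 * τ t) < R + ε :=
      (hΛ.eventually_mem hl).and (((hcω.eventually (lt_mem_nhds (by linarith))).and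
        (hcω.eventually (gt_mem_nhds (by linarith)))).and
        ((Tendsto.const_mul (2 * Real.pi * s) hcDl).eventually (gt_mem_nhds (by linarith))))
    obtain ⟨α, β, g, hαβ, hsub, hg, hg0, hG⟩ := exists_bump hU
    -- Here `m = ω'(l) - 2ε = (ω'(l) + R)/2` is positive because `R` is.
    have hkey := (h.bump_inequalities hΛ hτs hτpos hparseval hαβ (fun t ht => (hsub ht).1) hg hg0 hG
      (m := deriv ω l - 2 * ε) (m₁ := deriv ω l - ε) (M₁ := deriv ω l + ε) (M := deriv ω l + 2 * ε)
      (by linarith) (by linarith) (by linarith)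
      (fun t ht => ⟨(hsub ht).2.1.1.le, (hsub ht).2.1.2.le⟩) hs).2 hv hratio
    have hle : 2 * Real.pi * s * (∫ t, g t ^ 2) ≤
        (R + ε) * ∫ t, g t ^ 2 / (κ t ^ 2 * τ t) := by
      rw [← integral_const_mul, ← integral_const_mul]
      apply integral_mono ((hGint hg.continuous hg0).const_mul _)
        ((hQint (fun t ht => (hsub ht).1) hg.continuous hg0).const_mul _)
      intro t
      by_cases ht : t ∈ Set.Icc α β
      · obtain ⟨h1, -, h2⟩ := hsub ht
        have h3 := hDpos t h1
        simp only
        rw [mul_div_assoc', le_div_iff₀ h3]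
        calc 2 * Real.pi * s * g t ^ 2 * (κ t ^ 2 * τ t) =
            (2 * Real.pi * s * (κ t ^ 2 * τ t)) * g t ^ 2 := by ring
          _ ≤ (R + ε) * g t ^ 2 := by gcongr
      · simp [hg0 t fun h => ht ⟨h.1.le, h.2.le⟩]
    have hlt : R + ε < deriv ω l - 2 * ε := by rw [hε]; linarith
    have hGp : 0 < 2 * Real.pi * s * ∫ t, g t ^ 2 := by
      have := Real.pi_pos
      positivity
    nlinarith

theorem limit_identity (h : HasOscillatingAsymptotics a b Λ κ ω x v Φ)
    (hΛ : IsOpen Λ) (hΛne : Λ.Nonempty) {τ : ℝ → ℝ} (hτs : ContDiffOn ℝ (⊤ : ℕ∞) τ Λ)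
    (hτpos : ∀ l ∈ Λ, 0 < τ l)
    (hparseval : ∀ (F : ℝ → ℂ) (C : ℝ), Continuous F → (∀ t, ‖F t‖ ≤ C) → (∀ t ∉ Λ, F t = 0) →
      HasSum (fun n => ‖∫ t, (τ t : ℂ) * (F t * polyFun a b n t)‖ ^ 2) (∫ t, τ t * ‖F t‖ ^ 2))
    (hratio : Tendsto (fun n => (x (n + 1) - x n) / x n) atTop (𝓝 0)) {σ : EReal}
    (hσ : Tendsto (fun n => ((v n ^ 2 / (x (n + 1) - x n) : ℝ) : EReal)) atTop (𝓝 σ)) :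
    0 < σ ∧ σ < ⊤ ∧ ∀ l ∈ Λ, 2 * Real.pi * σ.toReal * τ l * κ l ^ 2 = deriv ω l := by
  have hpi := Real.pi_pos
  have hDpos : ∀ t ∈ Λ, 0 < κ t ^ 2 * τ t := fun t ht => by
    have := h.κ_pos t ht
    have := hτpos t ht
    positivity
  have hlow : ∀ s : ℝ, 0 < s → (s : EReal) < σ → ∀ l ∈ Λ,
      2 * Real.pi * s * (κ l ^ 2 * τ l) ≤ deriv ω l := by
    intro s hs hsσ l hl
    apply (h.density_bounds hΛ hτs hτpos hparseval hl hs).1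
    filter_upwards [hσ.eventually (lt_mem_nhds hsσ), h.x_lt] with n hn hx
    rw [EReal.coe_lt_coe_iff, lt_div_iff₀ (sub_pos.2 hx)] at hn
    exact hn.le
  have hupp : ∀ s : ℝ, 0 < s → σ < (s : EReal) → ∀ l ∈ Λ,
      deriv ω l ≤ 2 * Real.pi * s * (κ l ^ 2 * τ l) := by
    intro s hs hsσ l hl
    apply (h.density_bounds hΛ hτs hτpos hparseval hl hs).2 _ hratio
    filter_upwards [hσ.eventually (gt_mem_nhds hsσ), h.x_lt] with n hn hx
    rw [EReal.coe_lt_coe_iff, div_lt_iff₀ (sub_pos.2 hx)] at hn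
    exact hn.le
  obtain ⟨l₀, hl₀⟩ := hΛne
  have hω₀ := h.ω_deriv_pos l₀ hl₀
  have hD₀ := hDpos l₀ hl₀
  set c := 2 * Real.pi * (κ l₀ ^ 2 * τ l₀) with hc
  have hc0 : 0 < c := by positivity
  have h0 : 0 < σ := by
    by_contra hcon
    rw [not_lt] at hcon
    -- Half the critical value `ω'(l₀)/c`: admissible if `σ ≤ 0`, yet the upper estimate would force
    -- `ω' ≤ ω'/2`. Twice the critical value excludes `σ = ∞` below.
    have hs : 0 < deriv ω l₀ / (2 * c) := by positivity
    have h1 := hupp _ hs (hcon.trans_lt (by exact_mod_cast hs)) l₀ hl₀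
    have h2 : 2 * Real.pi * (deriv ω l₀ / (2 * c)) * (κ l₀ ^ 2 * τ l₀) = deriv ω l₀ / 2 := by
      rw [show 2 * Real.pi * (deriv ω l₀ / (2 * c)) * (κ l₀ ^ 2 * τ l₀) =
        (deriv ω l₀ / (2 * c)) * c by rw [hc]; ring]
      field_simp
    linarith
  have htop : σ < ⊤ := by
    rw [lt_top_iff_ne_top]
    intro htop
    have hs : 0 < 2 * deriv ω l₀ / c := by positivity
    have h1 := hlow _ hs (by rw [htop]; exact EReal.coe_lt_top _) l₀ hl₀
    have h2 : 2 * Real.pi * (2 * deriv ω l₀ / c) * (κ l₀ ^ 2 * τ l₀) = 2 * deriv ω l₀ := by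
      rw [show 2 * Real.pi * (2 * deriv ω l₀ / c) * (κ l₀ ^ 2 * τ l₀) =
        (2 * deriv ω l₀ / c) * c by rw [hc]; ring]
      field_simp
    linarith
  refine ⟨h0, htop, fun l hl => ?_⟩
  lift σ to ℝ using ⟨htop.ne, (bot_le.trans_lt h0).ne'⟩
  rw [EReal.toReal_coe]
  have hσ0 : 0 < σ := by exact_mod_cast h0
  have hlin : Continuous fun s : ℝ => 2 * Real.pi * s * (κ l ^ 2 * τ l) := by fun_prop
  have hle1 : 2 * Real.pi * σ * (κ l ^ 2 * τ l) ≤ deriv ω l := by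
    refine le_of_tendsto (x := 𝓝[<] σ) ((hlin.tendsto σ).mono_left nhdsWithin_le_nhds) ?_
    filter_upwards [Ioo_mem_nhdsLT hσ0] with s hs
    exact hlow s hs.1 (by exact_mod_cast hs.2) l hl
  have hle2 : deriv ω l ≤ 2 * Real.pi * σ * (κ l ^ 2 * τ l) := by
    refine ge_of_tendsto (x := 𝓝[>] σ) ((hlin.tendsto σ).mono_left nhdsWithin_le_nhds) ?_
    filter_upwards [self_mem_nhdsWithin] with s hs
    exact hupp s (hσ0.trans hs) (by exact_mod_cast hs) l hl
  linarith

end HasOscillatingAsymptotics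

/-! ### Power sequences -/

/-- This is the difference quotient of `(1 + y)^s` at `y = 0` with increment `1/n`. -/
theorem tendsto_mul_one_add_inv_rpow_sub_one (s : ℝ) :
    Tendsto (fun n : ℕ => (n : ℝ) * ((1 + (n : ℝ)⁻¹) ^ s - 1)) atTop (𝓝 s) := by
  have h1 : HasDerivAt (fun y : ℝ => (1 + y) ^ s) s 0 := by
    have h := (((hasDerivAt_id (0 : ℝ)).const_add 1).rpow_const (p := s) (Or.inl (by norm_num)))
    simpa using h
  have h2 := h1.tendsto_slope_zero_right
  have h3 : Tendsto (fun n : ℕ => ((n : ℝ)⁻¹)) atTop (𝓝[>] 0) :=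
    tendsto_inv_atTop_nhdsGT_zero.comp tendsto_natCast_atTop_atTop
  have h4 := h2.comp h3
  simpa [Function.comp_def] using h4

theorem rpow_succ_sub (s : ℝ) {n : ℕ} (hn : 0 < n) :
    ((n + 1 : ℕ) : ℝ) ^ s - (n : ℝ) ^ s =
      (n : ℝ) ^ (s - 1) * ((n : ℝ) * ((1 + (n : ℝ)⁻¹) ^ s - 1)) := by
  have hn0 : (0 : ℝ) < n := by exact_mod_cast hn
  have h1 : ((n + 1 : ℕ) : ℝ) = n * (1 + (n : ℝ)⁻¹) := by
    push_cast
    field_simp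
  rw [h1, Real.mul_rpow hn0.le (by positivity), ← mul_assoc,
    show (n : ℝ) ^ (s - 1) * n = (n : ℝ) ^ s by
      rw [← Real.rpow_add_one hn0.ne']; ring_nf]
  ring

theorem tendsto_rpow_succ_sub_div (s : ℝ) :
    Tendsto (fun n : ℕ => (((n + 1 : ℕ) : ℝ) ^ s - (n : ℝ) ^ s) / (n : ℝ) ^ s) atTop (𝓝 0) := by
  have h1 := (tendsto_mul_one_add_inv_rpow_sub_one s).mul
    (tendsto_inv_atTop_zero.comp (tendsto_natCast_atTop_atTop (R := ℝ)))
  rw [mul_zero] at h1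
  refine h1.congr' ?_
  filter_upwards [eventually_gt_atTop 0] with n hn
  have hn0 : (0 : ℝ) < n := by exact_mod_cast hn
  have hs0 : 0 < (n : ℝ) ^ s := by positivity
  rw [rpow_succ_sub s hn, Real.rpow_sub_one hn0.ne', Function.comp]
  field_simp

theorem rpow_neg_sq_div_rpow_succ_sub (r s : ℝ) {n : ℕ} (hn : 0 < n) :
    ((n : ℝ) ^ (-r)) ^ 2 / (((n + 1 : ℕ) : ℝ) ^ s - (n : ℝ) ^ s) =
      (n : ℝ) ^ (1 - 2 * r - s) * ((n : ℝ) * ((1 + (n : ℝ)⁻¹) ^ s - 1))⁻¹ := by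
  have hn0 : (0 : ℝ) < n := by exact_mod_cast hn
  rw [rpow_succ_sub s hn, ← Real.rpow_natCast, ← Real.rpow_mul hn0.le, div_eq_mul_inv, mul_inv,
    ← Real.rpow_neg hn0.le, ← mul_assoc, ← Real.rpow_add hn0]
  congr 2
  push_cast
  ring

end

theorem theorem4p5
    (a b : ℕ → ℝ) (ha : ∀ n, 0 < a n)
    (J : EllTwo →ₗ.[ℂ] EllTwo) (hJext : jacobiMin a b ≤ J) (hJ : IsSelfAdjoint J)
    (E : ProjectionMeasure EllTwo) (hE : IsSpectralFamily J E)
    (Λ : Set ℝ) (hΛopen : IsOpen Λ) (hΛconn : Λ.OrdConnected) (hΛne : Λ.Nonempty)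
    (τ : ℝ → ℝ) (hτsmooth : ContDiffOn ℝ (⊤ : ℕ∞) τ Λ) (hτpos : ∀ l ∈ Λ, 0 < τ l)
    (hτ : (E.measure basisZero).restrict Λ =
      (volume.restrict Λ).withDensity (fun l => ENNReal.ofReal (τ l)))
    (κ ω : ℝ → ℝ) (Φ : ℕ → ℝ → ℝ) :
    (∀ x v : ℕ → ℝ, HasOscillatingAsymptotics a b Λ κ ω x v Φ →
      Tendsto (fun n => (x (n + 1) - x n) / x n) atTop (𝓝 0) →
      ∀ σ : EReal,
        Tendsto (fun n => ((v n ^ 2 / (x (n + 1) - x n) : ℝ) : EReal)) atTop (𝓝 σ) →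
        0 < σ ∧ σ < ⊤ ∧
          ∀ l ∈ Λ, 2 * Real.pi * σ.toReal * τ l * κ l ^ 2 = deriv ω l) ∧
    (∀ r s : ℝ,
      HasOscillatingAsymptotics a b Λ κ ω
        (fun n => (n : ℝ) ^ s) (fun n => (n : ℝ) ^ (-r)) Φ →
      2 * r + s = 1 ∧
        ∀ l ∈ Λ, 2 * Real.pi * τ l * κ l ^ 2 = s * deriv ω l) := by
  have hparseval : ∀ (F : ℝ → ℂ) (C : ℝ), Continuous F → (∀ t, ‖F t‖ ≤ C) →
      (∀ t ∉ Λ, F t = 0) → HasSum (fun n => ‖∫ t, (τ t : ℂ) * (F t * polyFun a b n t)‖ ^ 2)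
        (∫ t, τ t * ‖F t‖ ^ 2) := fun F C hF hC hs =>
    hasSum_sq_norm_integral_density ha hJext hE hΛopen hτsmooth.continuousOn hτpos hτ hF hC hs
  refine ⟨fun x v h hratio σ hσ =>
    h.limit_identity hΛopen hΛne hτsmooth hτpos hparseval hratio hσ, fun r s h => ?_⟩
  have hs0 : 0 < s := by
    by_contra hs
    rw [not_lt] at hs
    obtain ⟨n, hn, hn1⟩ :=
      ((h.x_tendsto.eventually_gt_atTop 1).and (eventually_ge_atTop 1)).exists
    exact absurd (Real.rpow_le_one_of_one_le_of_nonpos (by exact_mod_cast hn1) hs) (not_le.2 hn)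
  have hmain := fun σ hσ => h.limit_identity hΛopen hΛne hτsmooth hτpos hparseval
    (tendsto_rpow_succ_sub_div s) (σ := σ) hσ
  have hinv : Tendsto (fun n : ℕ => ((n : ℝ) * ((1 + (n : ℝ)⁻¹) ^ s - 1))⁻¹) atTop (𝓝 s⁻¹) :=
    (tendsto_mul_one_add_inv_rpow_sub_one s).inv₀ hs0.ne'
  have hcongr : (fun n : ℕ => (n : ℝ) ^ (1 - 2 * r - s) *
      ((n : ℝ) * ((1 + (n : ℝ)⁻¹) ^ s - 1))⁻¹) =ᶠ[atTop]
      fun n : ℕ => ((n : ℝ) ^ (-r)) ^ 2 / (((n + 1 : ℕ) : ℝ) ^ s - (n : ℝ) ^ s) := by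
    filter_upwards [eventually_gt_atTop 0] with n hn
    rw [rpow_neg_sq_div_rpow_succ_sub r s hn]
  -- A negative exponent makes `σ_n → 0` and a positive one `σ_n → ∞`, both excluded; with exponent
  -- zero, `σ = 1/s`.
  have hexp : 1 - 2 * r - s = 0 := by
    rcases lt_trichotomy (1 - 2 * r - s) 0 with hlt | heq | hgt
    · exfalso
      have h1 : Tendsto (fun n : ℕ => (n : ℝ) ^ (1 - 2 * r - s)) atTop (𝓝 0) := by
        have := (tendsto_rpow_neg_atTop (neg_pos.2 hlt)).comp
          (tendsto_natCast_atTop_atTop (R := ℝ))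
        simpa [Function.comp_def] using this
      have h2 := (h1.mul hinv).congr' hcongr
      rw [zero_mul] at h2
      exact lt_irrefl _ (hmain 0 (continuous_coe_real_ereal.tendsto' 0 0 rfl |>.comp h2)).1
    · exact heq
    · exfalso
      have h1 : Tendsto (fun n : ℕ => (n : ℝ) ^ (1 - 2 * r - s)) atTop atTop :=
        (tendsto_rpow_atTop hgt).comp (tendsto_natCast_atTop_atTop (R := ℝ))
      have h2 := (h1.atTop_mul_pos (inv_pos.2 hs0) hinv).congr' hcongr
      exact lt_irrefl _ (hmain ⊤ (EReal.tendsto_coe_nhds_top_iff.2 h2)).2.1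
  refine ⟨by linarith, fun l hl => ?_⟩
  rw [hexp] at hcongr
  simp only [Real.rpow_zero, one_mul] at hcongr
  have h3 := (hmain (s⁻¹ : ℝ) ((continuous_coe_real_ereal.tendsto _).comp
    (hinv.congr' hcongr))).2.2 l hl
  rw [EReal.toReal_coe] at h3
  rw [← h3]
  field_simp
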